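/- Let $A$ be an $N\times N$ and $B$ an $M\times M$ irreducible, non-permutation matrix with entries in $\{0,1\}$. Let $\bar X_A=\{(x_n)_{n\in\mathbb Z}\in\{1,\dots,N\}^{\mathbb Z} : A(x_n,x_{n+1})=1 \text{ for all } n\}$, with the product topology, given by the metric $d(x,y)=2^{-m}$ for $x\neq y$, where $m$ is the largest $n\ge 0$ such that $x_k=y_k$ for all $|k|<n$, and let $\bar\sigma_A$ be the shift $\bar\sigma_A(x)_n=x_{n+1}$; similarly $(\bar X_B,\bar\sigma_B)$. Let $G_A^s$ and $G_A^u$ be the sets of pairs $(x,y)\in\bar X_A\times\bar X_A$ with $d(\bar\sigma_A^n x,\bar\sigma_A^n y)\to 0$ as $n\to\infty$, respectively as $n\to-\infty$. Give $G_A^s$ the inductive limit topology of its subspaces $\{(x,y): x_i=y_i \text{ for all } i\ge n\}\subset \bar X_A\times\bar X_A$, $n\geq 0$, and $G_A^u$ that of its subspaces $\{(x,y): x_i=y_i \text{ for all } i\le -n\}$, $n\ge 0$. Let $$G_A^{s,u}\rtimes\mathbb Z^2=\{(x,p,q,y)\in \bar X_A\times\mathbb Z\times\mathbb Z\times\bar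 X_A : (\bar\sigma_A^p x,y)\in G_A^s,\ (\bar\sigma_A^q x,y)\in G_A^u\}$$ be the étale groupoid with range $r(x,p,q,y)=x$, source $s(x,p,q,y)=y$, product $(x,p,q,y)(y,p',q',z)=(x,p+p',q+q',z)$, inverse $(x,p,q,y)^{-1}=(y,-p,-q,x)$, and the topology induced from $G_A^s\times G_A^u\times\mathbb Z^2$ by the injection $(x,p,q,y)\mapsto((\bar\sigma_A^p x,y),(\bar\sigma_A^q x,y),p,q)$. The extended Ruelle algebra $\widetilde{\mathcal R}_A=C^*(G_A^{s,u}\rtimes\mathbb Z^2)$ is its (reduced) groupoid $C^*$-algebra: the norm closure of the operators $\xi\mapsto a*\xi$, $(a*\xi)(\gamma)=\sum_{r(\eta)=r(\gamma)}a(\eta)\,\xi(\eta^{-1}\gamma)$, on $\ell^2(G_A^{s,u}\rtimes\mathbb Z^2)$, for $a\in C_c(G_A^{s,u}\rtimes\mathbb Z^2)$. A function $h\in C(\bar X_A)$ is regarded as the element of $C_c(G_A^{s,u}\rtimes\mathbb Z^2)\subset\widetilde{\mathcal R}_A$ with value $h(x)$ at $(x,0,0,x)$ and $0$ elsewhere,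 so that $C(\bar X_A)\subset\widetilde{\mathcal R}_A$. For $f\in C(\bar X_A,\mathbb Z)$ put $f^n=\sum_{i=0}^{n-1}f\circ\bar\sigma_A^i$ for $n\ge1$, $f^0=0$, $f^n=-\sum_{i=n}^{-1}f\circ\bar\sigma_A^i$ for $n\le-1$, and $$\tilde f^+(x,p,q,y)=\lim_{n\to\infty}\{f^{n+p}(\bar\sigma_A x)-f^n(\bar\sigma_A y)\},\qquad \tilde f^-(x,p,q,y)=\lim_{n\to-\infty}\{f^{n+q}(x)-f^n(y)\}.$$ For $(r,s)\in\mathbb T^2=(\mathbb R/\mathbb Z)^2$ let $U_{(r,s)}(\tilde f)$ be the unitary operator on $\ell^2(G_A^{s,u}\rtimes\mathbb Z^2)$ of multiplication by the function $\gamma\mapsto\exp\{2\pi\sqrt{-1}(\tilde f^+(\gamma)s+\tilde f^-(\gamma)r)\}$, and let $\gamma^{A,f}_{(r,s)}\in\operatorname{Aut}(\widetilde{\mathcal R}_A)$ be the automorphism $a\mapsto U_{(r,s)}(\tilde f)\,a\,U_{(r,s)}(\tilde f)^*$. The same notation is used for $B$. **Proposition.** Let $\varphi:\bar X_A\to\bar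 X_B$ be a topological conjugacy, that is, a homeomorphism with $\varphi\circ\bar\sigma_A=\bar\sigma_B\circ\varphi$, and suppose that $f\in C(\bar X_A,\mathbb Z)$ and $g\in C(\bar X_B,\mathbb Z)$ satisfy $f=g\circ\varphi$. Then there exists an isomorphism $\Phi:\widetilde{\mathcal R}_A\to\widetilde{\mathcal R}_B$ of $C^*$-algebras such that $$\Phi(C(\bar X_A))=C(\bar X_B),\qquad \Phi\circ\gamma^{A,f}_{(r,s)}=\gamma^{B,g}_{(r,s)}\circ\Phi\quad\text{for all }(r,s)\in\mathbb T^2.$$ -/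

import Mathlib

noncomputable section

open Filter Topology
open scoped ENNReal CompactlySupported

namespace MarkovShift

/-! ### Two-sided topological Markov shifts -/

/-- The two-sided shift space of a `0`-`1` matrix `A`: the bi-infinite sequences
`(x n)_{n ∈ ℤ}` with `A (x n) (x (n + 1)) = 1` for all `n`, with the product topology. -/
abbrev ShiftSpace {N : ℕ} (A : Matrix (Fin N) (Fin N) ℤ) : Type :=
  {x : ℤ → Fin N // ∀ n : ℤ, A (x n) (x (n + 1)) = 1}

variable {N : ℕ} {A : Matrix (Fin N) (Fin N) ℤ}

/-- The `n`-th power (`n ∈ ℤ`) of the shift homeomorphism: `(σⁿ x)_k = x_{k + n}`. -/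
def shiftZ (n : ℤ) (x : ShiftSpace A) : ShiftSpace A :=
  ⟨fun k => x.1 (k + n), fun k => by
    have h := x.2 (k + n)
    rwa [show k + n + 1 = k + 1 + n by ring] at h⟩

/-- The shift transformation `σ`, `(σ x)_k = x_{k + 1}`. -/
def shift (x : ShiftSpace A) : ShiftSpace A := shiftZ 1 x

theorem shiftZ_shiftZ (m n : ℤ) (x : ShiftSpace A) :
    shiftZ m (shiftZ n x) = shiftZ (m + n) x := by
  apply Subtype.ext; funext k; simp [shiftZ, add_assoc]

theorem shiftZ_zero (x : ShiftSpace A) : shiftZ 0 x = x := by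
  apply Subtype.ext; funext k; simp [shiftZ]

theorem continuous_shiftZ (n : ℤ) : Continuous (shiftZ n : ShiftSpace A → ShiftSpace A) := by
  apply Continuous.subtype_mk
  exact continuous_pi fun k => (continuous_apply (k + n)).comp continuous_subtype_val

/-- The shift space is compact. -/
instance instCompactSpace : CompactSpace (ShiftSpace A) := by
  apply isCompact_iff_compactSpace.mp
  apply IsClosed.isCompact
  have : {x : ℤ → Fin N | ∀ n : ℤ, A (x n) (x (n + 1)) = 1}
      = ⋂ n : ℤ, (fun x : ℤ → Fin N => A (x n) (x (n + 1))) ⁻¹' {1} := by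
    ext x; simp
  show IsClosed {x : ℤ → Fin N | ∀ n : ℤ, A (x n) (x (n + 1)) = 1}
  rw [this]
  refine isClosed_iInter fun n => IsClosed.preimage ?_ (isClosed_discrete _)
  have h2 : Continuous fun z : Fin N × Fin N => A z.1 z.2 := continuous_of_discreteTopology
  exact h2.comp (Continuous.prodMk (continuous_apply (A := fun _ : ℤ => Fin N) n)
    (continuous_apply (A := fun _ : ℤ => Fin N) (n + 1)))

/-- The usual metric of the shift space: `d (x, y) = λ ^ m` where `m` is the largest `n` such that
`x_k = y_k` for all `|k| < n` (so `d (x, y) = 1` if `x_0 ≠ y_0`), and `d (x, x) = 0`;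
the ratio `0 < λ < 1` is fixed to be `1 / 2`. -/
def shiftDist (x y : ShiftSpace A) : ℝ :=
  open Classical in
  if x = y then 0 else (1 / 2 : ℝ) ^ sSup {n : ℕ | ∀ k : ℤ, |k| < n → x.1 k = y.1 k}

/-- Stable equivalence: `d (σⁿ x, σⁿ y) → 0` as `n → ∞`. -/
def Stable (x y : ShiftSpace A) : Prop :=
  Tendsto (fun n : ℤ => shiftDist (shiftZ n x) (shiftZ n y)) atTop (𝓝 0)

/-- Unstable equivalence: `d (σⁿ x, σⁿ y) → 0` as `n → -∞`. -/
def Unstable (x y : ShiftSpace A) : Prop :=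
  Tendsto (fun n : ℤ => shiftDist (shiftZ n x) (shiftZ n y)) atBot (𝓝 0)

theorem shiftDist_nonneg (x y : ShiftSpace A) : 0 ≤ shiftDist x y := by
  unfold shiftDist; split_ifs <;> positivity

theorem shiftDist_le {x y : ShiftSpace A} {M : ℕ} (h : ∀ k : ℤ, |k| < M → x.1 k = y.1 k) :
    shiftDist x y ≤ (1 / 2 : ℝ) ^ M := by
  unfold shiftDist
  split_ifs with hxy
  · positivity
  · refine pow_le_pow_of_le_one (by norm_num) (by norm_num) (le_csSup ?_ h)
    by_contra hb
    apply hxy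
    apply Subtype.ext
    funext k
    rw [not_bddAbove_iff] at hb
    obtain ⟨m, hm, hkm⟩ := hb k.natAbs
    exact hm k (by rw [Int.abs_eq_natAbs]; exact_mod_cast hkm)

theorem shiftDist_eq_one {x y : ShiftSpace A} (h : x.1 0 ≠ y.1 0) : shiftDist x y = 1 := by
  have hxy : x ≠ y := fun e => h (by rw [e])
  have hs : {n : ℕ | ∀ k : ℤ, |k| < n → x.1 k = y.1 k} = {0} := by
    ext n
    simp only [Set.mem_ofPred_eq, Set.mem_singleton_iff]
    constructor
    · intro hn
      by_contra h0
      exact h (hn 0 (by simpa using Nat.pos_of_ne_zero h0))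
    · rintro rfl k hk
      simp only [Nat.cast_zero] at hk
      exact absurd hk (not_lt.mpr (abs_nonneg k))
  unfold shiftDist
  rw [if_neg hxy, hs]
  simp

theorem stable_iff {x y : ShiftSpace A} :
    Stable x y ↔ ∃ n : ℕ, ∀ i : ℤ, (n : ℤ) ≤ i → x.1 i = y.1 i := by
  constructor
  · intro h
    have h1 := h.eventually (gt_mem_nhds (show (0 : ℝ) < 1 by norm_num))
    obtain ⟨n, hn⟩ := eventually_atTop.mp h1
    refine ⟨n.toNat, fun i hi => ?_⟩
    by_contra hne
    refine absurd (hn i (by omega)) (not_lt.mpr (le_of_eq (shiftDist_eq_one ?_).symm))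
    simpa [shiftZ] using hne
  · rintro ⟨n, hn⟩
    refine squeeze_zero' (Eventually.of_forall fun _ => shiftDist_nonneg _ _)
      (g := fun j : ℤ => (1 / 2 : ℝ) ^ (j - n).toNat) ?_ ?_
    · filter_upwards [eventually_ge_atTop (n : ℤ)] with j hj
      refine shiftDist_le fun k hk => hn (k + j) ?_
      rw [abs_lt] at hk
      omega
    · refine (tendsto_pow_atTop_nhds_zero_of_lt_one (by norm_num) (by norm_num)).comp ?_
      refine tendsto_atTop.mpr fun b => ?_
      filter_upwards [eventually_ge_atTop ((n : ℤ) + b)] with j hj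
      omega

theorem unstable_iff {x y : ShiftSpace A} :
    Unstable x y ↔ ∃ n : ℕ, ∀ i : ℤ, i ≤ -(n : ℤ) → x.1 i = y.1 i := by
  constructor
  · intro h
    have h1 := h.eventually (gt_mem_nhds (show (0 : ℝ) < 1 by norm_num))
    obtain ⟨n, hn⟩ := eventually_atBot.mp h1
    refine ⟨(-n).toNat, fun i hi => ?_⟩
    by_contra hne
    refine absurd (hn i (by omega)) (not_lt.mpr (le_of_eq (shiftDist_eq_one ?_).symm))
    simpa [shiftZ] using hne
  · rintro ⟨n, hn⟩
    refine squeeze_zero' (Eventually.of_forall fun _ => shiftDist_nonneg _ _)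
      (g := fun j : ℤ => (1 / 2 : ℝ) ^ (-j - n).toNat) ?_ ?_
    · filter_upwards [eventually_le_atBot (-(n : ℤ))] with j hj
      refine shiftDist_le fun k hk => hn (k + j) ?_
      rw [abs_lt] at hk
      omega
    · refine (tendsto_pow_atTop_nhds_zero_of_lt_one (by norm_num) (by norm_num)).comp ?_
      refine tendsto_atTop.mpr fun b => ?_
      filter_upwards [eventually_le_atBot (-((n : ℤ) + b))] with j hj
      omega

theorem Stable.symm {x y : ShiftSpace A} (h : Stable x y) : Stable y x := by
  rw [stable_iff] at *
  exact h.imp fun n hn i hi => (hn i hi).symm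

theorem Unstable.symm {x y : ShiftSpace A} (h : Unstable x y) : Unstable y x := by
  rw [unstable_iff] at *
  exact h.imp fun n hn i hi => (hn i hi).symm

theorem Stable.trans {x y z : ShiftSpace A} (h : Stable x y) (h' : Stable y z) : Stable x z := by
  rw [stable_iff] at *
  obtain ⟨n, hn⟩ := h
  obtain ⟨m, hm⟩ := h'
  exact ⟨n + m, fun i hi => (hn i (by omega)).trans (hm i (by omega))⟩

theorem Unstable.trans {x y z : ShiftSpace A} (h : Unstable x y) (h' : Unstable y z) :
    Unstable x z := by
  rw [unstable_iff] at *
  obtain ⟨n, hn⟩ := h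
  obtain ⟨m, hm⟩ := h'
  exact ⟨n + m, fun i hi => (hn i (by omega)).trans (hm i (by omega))⟩

theorem Stable.shiftZ {x y : ShiftSpace A} (h : Stable x y) (k : ℤ) :
    Stable (shiftZ k x) (shiftZ k y) := by
  have := h.comp (tendsto_atTop_add_const_right atTop k tendsto_id)
  simpa only [Stable, Function.comp_def, shiftZ_shiftZ, id] using this

theorem Unstable.shiftZ {x y : ShiftSpace A} (h : Unstable x y) (k : ℤ) :
    Unstable (shiftZ k x) (shiftZ k y) := by
  have := h.comp (tendsto_atBot_add_const_right atBot k tendsto_id)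
  simpa only [Unstable, Function.comp_def, shiftZ_shiftZ, id] using this

theorem Stable.refl (x : ShiftSpace A) : Stable x x := stable_iff.mpr ⟨0, fun _ _ => rfl⟩

theorem Unstable.refl (x : ShiftSpace A) : Unstable x x := unstable_iff.mpr ⟨0, fun _ _ => rfl⟩

/-! ### The stable and unstable groupoids with their inductive limit topologies -/

/-- The inductive limit topology on a set `S = ⋃ₙ E n` of points of a space `Z`, each `E n`
carrying the relative topology of `Z`: a set is open iff its trace on every `E n` is open. -/
abbrev indLim {Z : Type} [TopologicalSpace Z] (S : Set Z) (E : ℕ → Set Z) : TopologicalSpace S :=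
  ⨆ n : ℕ, TopologicalSpace.coinduced
    (fun z : {z : S // (z : Z) ∈ E n} => (z : S))
    (TopologicalSpace.induced (fun z : {z : S // (z : Z) ∈ E n} => ((z : S) : Z)) inferInstance)

theorem isOpen_indLim {Z : Type} [TopologicalSpace Z] {S : Set Z} {E : ℕ → Set Z} {U : Set S} :
    IsOpen[indLim S E] U ↔
      ∀ n, ∃ V : Set Z, IsOpen V ∧ ∀ z : S, (z : Z) ∈ E n → (z ∈ U ↔ (z : Z) ∈ V) := by
  unfold indLim
  rw [isOpen_iSup_iff]
  refine forall_congr' fun n => ?_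
  rw [isOpen_coinduced, isOpen_induced_iff]
  refine exists_congr fun V => and_congr_right fun _ => ?_
  constructor
  · intro h z hz
    have := Set.ext_iff.mp h ⟨z, hz⟩
    exact this.symm
  · intro h
    ext ⟨z, hz⟩
    exact (h z hz).symm

theorem continuous_val_indLim {Z : Type} [TopologicalSpace Z] (S : Set Z) (E : ℕ → Set Z) :
    @Continuous S Z (indLim S E) _ Subtype.val := by
  refine @Continuous.mk _ _ (indLim S E) _ _ fun V hV => ?_
  rw [isOpen_indLim]
  exact fun n => ⟨V, hV, fun z _ => Iff.rfl⟩

/-- The pairs `(x, y)` with `(σⁿ x, σⁿ y) ∈ G^{s,0}`, that is, `x_i = y_i` for all `i ≥ n`. -/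
def levelS (A : Matrix (Fin N) (Fin N) ℤ) (n : ℕ) : Set (ShiftSpace A × ShiftSpace A) :=
  {z | ∀ i : ℤ, (n : ℤ) ≤ i → z.1.1 i = z.2.1 i}

/-- The pairs `(x, y)` with `(σ⁻ⁿ x, σ⁻ⁿ y) ∈ G^{u,0}`, that is, `x_i = y_i` for all `i ≤ -n`. -/
def levelU (A : Matrix (Fin N) (Fin N) ℤ) (n : ℕ) : Set (ShiftSpace A × ShiftSpace A) :=
  {z | ∀ i : ℤ, i ≤ -(n : ℤ) → z.1.1 i = z.2.1 i}

/-- The stable groupoid `G_A^s`, as a set of pairs. -/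
def StableRel (A : Matrix (Fin N) (Fin N) ℤ) : Set (ShiftSpace A × ShiftSpace A) :=
  {z | Stable z.1 z.2}

/-- The unstable groupoid `G_A^u`, as a set of pairs. -/
def UnstableRel (A : Matrix (Fin N) (Fin N) ℤ) : Set (ShiftSpace A × ShiftSpace A) :=
  {z | Unstable z.1 z.2}

theorem stableRel_eq_iUnion : StableRel A = ⋃ n, levelS A n := by
  ext z; simp only [StableRel, levelS, Set.mem_iUnion, Set.mem_ofPred_eq, stable_iff]

theorem unstableRel_eq_iUnion : UnstableRel A = ⋃ n, levelU A n := by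
  ext z; simp only [UnstableRel, levelU, Set.mem_iUnion, Set.mem_ofPred_eq, unstable_iff]

/-- `G_A^s` as a topological space: the inductive limit of the sets `levelS A n`. -/
def Gs (A : Matrix (Fin N) (Fin N) ℤ) : Type := StableRel A

/-- `G_A^u` as a topological space: the inductive limit of the sets `levelU A n`. -/
def Gu (A : Matrix (Fin N) (Fin N) ℤ) : Type := UnstableRel A

instance instTopGs : TopologicalSpace (Gs A) := indLim (StableRel A) (levelS A)

instance instTopGu : TopologicalSpace (Gu A) := indLim (UnstableRel A) (levelU A)

/-! ### The groupoid `G_A^{s,u} ⋊ ℤ²` -/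

/-- The groupoid `G_A^{s,u} ⋊ ℤ²` of the quadruples `(x, p, q, y)` such that `(σᵖ x, y) ∈ G_A^s` and
`(σ^q x, y) ∈ G_A^u`. The range of `(x, p, q, y)` is `x`, its source is `y`. -/
@[ext]
structure Gsu (A : Matrix (Fin N) (Fin N) ℤ) : Type where
  x : ShiftSpace A
  p : ℤ
  q : ℤ
  y : ShiftSpace A
  stable : Stable (shiftZ p x) y
  unstable : Unstable (shiftZ q x) y

namespace Gsu

/-- The product `(x, p, q, y) (y, p', q', z) = (x, p + p', q + q', z)`. -/
def mul (g h : Gsu A) (e : g.y = h.x) : Gsu A where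
  x := g.x
  p := g.p + h.p
  q := g.q + h.q
  y := h.y
  stable := by
    have h1 := g.stable.shiftZ h.p
    rw [shiftZ_shiftZ, e, add_comm] at h1
    exact h1.trans h.stable
  unstable := by
    have h1 := g.unstable.shiftZ h.q
    rw [shiftZ_shiftZ, e, add_comm] at h1
    exact h1.trans h.unstable

/-- The inverse `(x, p, q, y)⁻¹ = (y, -p, -q, x)`. -/
def inv (g : Gsu A) : Gsu A where
  x := g.y
  p := -g.p
  q := -g.q
  y := g.x
  stable := by
    have h1 := (g.stable.shiftZ (-g.p)).symm
    rwa [shiftZ_shiftZ, neg_add_cancel, shiftZ_zero] at h1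
  unstable := by
    have h1 := (g.unstable.shiftZ (-g.q)).symm
    rwa [shiftZ_shiftZ, neg_add_cancel, shiftZ_zero] at h1

/-- The unit `(x, 0, 0, x)`. -/
def unit (x : ShiftSpace A) : Gsu A where
  x := x
  p := 0
  q := 0
  y := x
  stable := by rw [shiftZ_zero]; exact Stable.refl x
  unstable := by rw [shiftZ_zero]; exact Unstable.refl x

/-- `(x, p, q, y) ↦ ((σᵖ x, y), (σ^q x, y), p, q) ∈ G_A^s × G_A^u × ℤ × ℤ`. -/
def toProd (g : Gsu A) : Gs A × Gu A × ℤ × ℤ :=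
  (⟨(shiftZ g.p g.x, g.y), g.stable⟩, ⟨(shiftZ g.q g.x, g.y), g.unstable⟩, g.p, g.q)

/-- The topology of `G_A^{s,u} ⋊ ℤ²`, as a subspace of `G_A^s × G_A^u × ℤ × ℤ`. -/
instance instTopGsu : TopologicalSpace (Gsu A) :=
  TopologicalSpace.induced toProd inferInstance

theorem continuous_toProd : Continuous (toProd : Gsu A → _) := continuous_induced_dom

theorem continuous_p : Continuous (p : Gsu A → ℤ) :=
  continuous_fst.comp (continuous_snd.comp (continuous_snd.comp continuous_toProd))

theorem continuous_q : Continuous (q : Gsu A → ℤ) :=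
  continuous_snd.comp (continuous_snd.comp (continuous_snd.comp continuous_toProd))

theorem continuous_toGs : Continuous (fun g : Gsu A => g.toProd.1) :=
  continuous_fst.comp continuous_toProd

theorem continuous_toGu : Continuous (fun g : Gsu A => g.toProd.2.1) :=
  continuous_fst.comp (continuous_snd.comp continuous_toProd)

theorem continuous_pairS :
    Continuous (fun g : Gsu A => ((shiftZ g.p g.x, g.y) : ShiftSpace A × ShiftSpace A)) :=
  (show Continuous (fun z : Gs A => z.1) from
    continuous_val_indLim (StableRel A) (levelS A)).comp continuous_toGs

theorem continuous_y : Continuous (y : Gsu A → ShiftSpace A) :=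
  continuous_snd.comp continuous_pairS

theorem continuous_shiftZ_uncurry :
    Continuous (fun z : ℤ × ShiftSpace A => shiftZ z.1 z.2) :=
  continuous_prod_of_discrete_left.mpr continuous_shiftZ

theorem continuous_x : Continuous (x : Gsu A → ShiftSpace A) := by
  have h : Continuous (fun g : Gsu A => shiftZ (-g.p) (shiftZ g.p g.x)) :=
    continuous_shiftZ_uncurry.comp
      (continuous_p.neg.prodMk (continuous_fst.comp continuous_pairS))
  simpa only [shiftZ_shiftZ, neg_add_cancel, shiftZ_zero] using h

theorem isOpen_agree (a b : ℤ) :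
    IsOpen {z : ShiftSpace A × ShiftSpace A | ∀ i ∈ Set.Icc a b, z.1.1 i = z.2.1 i} := by
  have : {z : ShiftSpace A × ShiftSpace A | ∀ i ∈ Set.Icc a b, z.1.1 i = z.2.1 i}
      = ⋂ i ∈ Set.Icc a b, {z | z.1.1 i = z.2.1 i} := by ext z; simp
  rw [this]
  refine (Set.finite_Icc a b).isOpen_biInter fun i _ => ?_
  have h : Continuous (fun z : ShiftSpace A × ShiftSpace A => (z.1.1 i, z.2.1 i)) :=
    (((continuous_apply i).comp continuous_subtype_val).comp continuous_fst).prodMk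
      (((continuous_apply i).comp continuous_subtype_val).comp continuous_snd)
  exact h.isOpen_preimage {w | w.1 = w.2} (isOpen_discrete _)

theorem isOpen_levelS (n : ℕ) : IsOpen {z : Gs A | z.1 ∈ levelS A n} := by
  refine isOpen_indLim.mpr fun m => ⟨_, isOpen_agree (n : ℤ) m, fun z hz => ?_⟩
  constructor
  · exact fun h i hi => h i hi.1
  · intro h i hi
    by_cases him : i ≤ m
    · exact h i ⟨hi, him⟩
    · exact hz i (by omega)

theorem isOpen_levelU (n : ℕ) : IsOpen {z : Gu A | z.1 ∈ levelU A n} := by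
  refine isOpen_indLim.mpr fun m => ⟨_, isOpen_agree (-(m : ℤ)) (-(n : ℤ)), fun z hz => ?_⟩
  constructor
  · exact fun h i hi => h i hi.2
  · intro h i hi
    by_cases him : -(m : ℤ) ≤ i
    · exact h i ⟨him, hi⟩
    · exact hz i (by omega)

/-- The open sets of those `(x, p, q, y)` with fixed `p`, `q` for which `σᵖ x`, `y` agree from `n`
on and `σ^q x`, `y` agree up to `-m`. -/
def box (A : Matrix (Fin N) (Fin N) ℤ) (p q : ℤ) (n m : ℕ) : Set (Gsu A) :=
  {g | g.p = p ∧ g.q = q ∧ (shiftZ g.p g.x, g.y) ∈ levelS A n ∧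
    (shiftZ g.q g.x, g.y) ∈ levelU A m}

theorem isOpen_box (p q : ℤ) (n m : ℕ) : IsOpen (box A p q n m) :=
  ((isOpen_discrete {p}).preimage continuous_p).inter <|
    ((isOpen_discrete {q}).preimage continuous_q).inter <|
      ((isOpen_levelS n).preimage continuous_toGs).inter
        ((isOpen_levelU m).preimage continuous_toGu)

theorem exists_mem_box (g : Gsu A) : ∃ n m : ℕ, g ∈ box A g.p g.q n m := by
  obtain ⟨n, hn⟩ := stable_iff.mp g.stable
  obtain ⟨m, hm⟩ := unstable_iff.mp g.unstable
  exact ⟨n, m, rfl, rfl, hn, hm⟩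

/-- The range and source maps are locally injective. -/
theorem exists_isOpen_injOn (g : Gsu A) :
    ∃ U : Set (Gsu A), IsOpen U ∧ g ∈ U ∧ Set.InjOn x U ∧ Set.InjOn y U := by
  obtain ⟨n, m, hg⟩ := exists_mem_box g
  set a : ℤ := -(m : ℤ) - |g.p| - |g.q| with ha
  set b : ℤ := (n : ℤ) + |g.p| + |g.q| with hb
  have hp1 := le_abs_self g.p
  have hp2 := neg_abs_le g.p
  have hq1 := le_abs_self g.q
  have hq2 := neg_abs_le g.q
  have hx : IsOpen {h : Gsu A | ∀ i ∈ Set.Icc a b, h.x.1 i = g.x.1 i} :=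
    (isOpen_agree a b).preimage (continuous_x.prodMk continuous_const)
  have hy : IsOpen {h : Gsu A | ∀ i ∈ Set.Icc a b, h.y.1 i = g.y.1 i} :=
    (isOpen_agree a b).preimage (continuous_y.prodMk continuous_const)
  refine ⟨box A g.p g.q n m ∩ ({h | ∀ i ∈ Set.Icc a b, h.x.1 i = g.x.1 i} ∩
    {h | ∀ i ∈ Set.Icc a b, h.y.1 i = g.y.1 i}), (isOpen_box _ _ _ _).inter (hx.inter hy),
    ⟨hg, fun _ _ => rfl, fun _ _ => rfl⟩, ?_, ?_⟩
  · rintro h ⟨⟨hp, hq, hs, hu⟩, hhx, hhy⟩ k ⟨⟨kp, kq, ks, ku⟩, kx, ky⟩ e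
    have : h.y = k.y := by
      apply Subtype.ext
      funext i
      by_cases h1 : (n : ℤ) ≤ i
      · have e1 := hs i h1
        have e2 := ks i h1
        simp only [shiftZ, hp, kp, e] at e1 e2
        rw [← e1, ← e2]
      by_cases h2 : i ≤ -(m : ℤ)
      · have e1 := hu i h2
        have e2 := ku i h2
        simp only [shiftZ, hq, kq, e] at e1 e2
        rw [← e1, ← e2]
      · rw [hhy i ⟨by omega, by omega⟩, ky i ⟨by omega, by omega⟩]
    exact Gsu.ext e (hp.trans kp.symm) (hq.trans kq.symm) this
  · rintro h ⟨⟨hp, hq, hs, hu⟩, hhx, hhy⟩ k ⟨⟨kp, kq, ks, ku⟩, kx, ky⟩ e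
    have : h.x = k.x := by
      apply Subtype.ext
      funext i
      by_cases h1 : (n : ℤ) ≤ i - g.p
      · have e1 := hs _ h1
        have e2 := ks _ h1
        simp only [shiftZ, hp, kp, e, sub_add_cancel] at e1 e2
        rw [e1, e2]
      by_cases h2 : i - g.q ≤ -(m : ℤ)
      · have e1 := hu _ h2
        have e2 := ku _ h2
        simp only [shiftZ, hq, kq, e, sub_add_cancel] at e1 e2
        rw [e1, e2]
      · rw [hhx i ⟨by omega, by omega⟩, kx i ⟨by omega, by omega⟩]
    exact Gsu.ext this (hp.trans kp.symm) (hq.trans kq.symm) e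

end Gsu

/-! ### The left regular representation and the extended Ruelle algebra -/

namespace Gsu

/-- The convolution `(a * ξ)(γ) = ∑_{η : r(η) = r(γ)} a(η) ξ(η⁻¹ γ)`. -/
def conv (a ξ : Gsu A → ℂ) (γ : Gsu A) : ℂ :=
  ∑' η : {η : Gsu A // η.x = γ.x}, a η.1 * ξ (mul (inv η.1) γ η.2)

/-- Reindexing `(γ, η) ↦ (η⁻¹ γ, η)`. -/
def reindex (A : Matrix (Fin N) (Fin N) ℤ) :
    (Σ γ : Gsu A, {η : Gsu A // η.x = γ.x}) ≃ (Σ δ : Gsu A, {η : Gsu A // η.y = δ.x}) where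
  toFun z := ⟨mul (inv z.2.1) z.1 z.2.2, ⟨z.2.1, rfl⟩⟩
  invFun z := ⟨mul z.2.1 z.1 z.2.2, ⟨z.2.1, rfl⟩⟩
  left_inv := by
    rintro ⟨⟨x, p, q, y, hs, hu⟩, ⟨η, e⟩⟩
    obtain rfl : η.x = x := e
    have : mul η (mul (inv η) ⟨η.x, p, q, y, hs, hu⟩ rfl) rfl = ⟨η.x, p, q, y, hs, hu⟩ := by
      apply Gsu.ext <;> simp [mul, inv]
    exact Sigma.subtype_ext this rfl
  right_inv := by
    rintro ⟨⟨x, p, q, y, hs, hu⟩, ⟨η, e⟩⟩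
    obtain rfl : η.y = x := e
    have : mul (inv η) (mul η ⟨η.y, p, q, y, hs, hu⟩ rfl) rfl = ⟨η.y, p, q, y, hs, hu⟩ := by
      apply Gsu.ext <;> simp [mul, inv]
    exact Sigma.subtype_ext this rfl

/-- A compactly supported function is summable along the fibres of the range and source maps, with
a uniform bound. -/
theorem exists_fibre_bound (a : C_c(Gsu A, ℂ)) :
    ∃ L : ℝ≥0∞, L ≠ ⊤ ∧
      (∀ z, ∑' η : {η : Gsu A // η.x = z}, ‖a η.1‖ₑ ≤ L) ∧
      (∀ z, ∑' η : {η : Gsu A // η.y = z}, ‖a η.1‖ₑ ≤ L) := by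
  choose U hUo hUm hUx hUy using exists_isOpen_injOn (A := A)
  have hK : IsCompact (tsupport a) := a.hasCompactSupport
  obtain ⟨t, ht⟩ := hK.elim_finite_subcover U hUo (fun g _ => Set.mem_iUnion.mpr ⟨g, hUm g⟩)
  obtain ⟨C, hC⟩ := a.hasCompactSupport.exists_bound_of_continuous a.continuous
  have hCe : ∀ η, ‖a η‖ₑ ≤ ENNReal.ofReal C := fun η => by
    rw [← ofReal_norm]; exact ENNReal.ofReal_le_ofReal (hC η)
  have key : ∀ (π : Gsu A → ShiftSpace A), (∀ g, Set.InjOn π (U g)) →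
      ∀ z, ∑' η : {η : Gsu A // π η = z}, ‖a η.1‖ₑ ≤ t.card * ENNReal.ofReal C := by
    intro π hπ z
    have h1 : ∀ η : {η : Gsu A // π η = z},
        ‖a η.1‖ₑ ≤ ∑ g ∈ t, (U g).indicator (fun η => ‖a η‖ₑ) η.1 := by
      intro η
      by_cases h0 : a η.1 = 0
      · simp [h0]
      obtain ⟨g, hg⟩ := Set.mem_iUnion.mp (ht (subset_tsupport _ h0))
      obtain ⟨hgt, hg⟩ := Set.mem_iUnion.mp hg
      calc ‖a η.1‖ₑ = (U g).indicator (fun η => ‖a η‖ₑ) η.1 := by rw [Set.indicator_of_mem hg]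
        _ ≤ _ := Finset.single_le_sum
          (f := fun g => (U g).indicator (fun η => ‖a η‖ₑ) η.1) (fun _ _ => zero_le) hgt
    refine (ENNReal.tsum_le_tsum h1).trans ?_
    rw [Summable.tsum_finsetSum fun _ _ => ENNReal.summable, ← nsmul_eq_mul]
    refine Finset.sum_le_card_nsmul _ _ _ fun g _ => ?_
    by_cases hex : ∃ η : {η : Gsu A // π η = z}, η.1 ∈ U g
    · obtain ⟨η₀, h₀⟩ := hex
      rw [tsum_eq_single η₀]
      · rw [Set.indicator_of_mem h₀]; exact hCe _
      · intro η hne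
        refine Set.indicator_of_notMem (fun hmem => hne ?_) _
        exact Subtype.ext (hπ g hmem h₀ (η.2.trans η₀.2.symm))
    · rw [ENNReal.tsum_eq_zero.mpr]
      · exact zero_le
      · intro η
        exact Set.indicator_of_notMem (fun hmem => hex ⟨η, hmem⟩) _
  exact ⟨t.card * ENNReal.ofReal C, ENNReal.mul_ne_top (ENNReal.natCast_ne_top _)
    ENNReal.ofReal_ne_top, key x hUx, key y hUy⟩

theorem tsum_mul_sq_le {ι : Type} (u v : ι → ℝ≥0∞) :
    (∑' i, u i * v i) ^ 2 ≤ (∑' i, u i) * ∑' i, u i * v i ^ 2 := by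
  have h : ∀ s : Finset ι, (∑ i ∈ s, u i * v i) ^ 2 ≤ (∑' i, u i) * ∑' i, u i * v i ^ 2 := by
    intro s
    have h1 := ENNReal.inner_le_Lp_mul_Lq s (fun i => u i ^ (1 / 2 : ℝ))
      (fun i => u i ^ (1 / 2 : ℝ) * v i) (p := 2) (q := 2) Real.HolderConjugate.two_two
    have e1 : ∀ c : ℝ≥0∞, c ^ (1 / 2 : ℝ) * c ^ (1 / 2 : ℝ) = c := fun c => by
      rw [← ENNReal.rpow_add_of_nonneg _ _ (by norm_num) (by norm_num)]; norm_num
    have e2 : ∀ c : ℝ≥0∞, (c ^ (1 / 2 : ℝ)) ^ (2 : ℝ) = c := fun c => by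
      rw [← ENNReal.rpow_mul]; norm_num
    simp only [← mul_assoc, e1, ENNReal.mul_rpow_of_nonneg _ _ (show (0 : ℝ) ≤ 2 by norm_num),
      e2] at h1
    calc (∑ i ∈ s, u i * v i) ^ 2
        ≤ ((∑ i ∈ s, u i) ^ (1 / 2 : ℝ) * (∑ i ∈ s, u i * v i ^ (2 : ℝ)) ^ (1 / 2 : ℝ)) ^ 2 := by
          gcongr
      _ = (∑ i ∈ s, u i) * ∑ i ∈ s, u i * v i ^ 2 := by
          rw [mul_pow, pow_two, pow_two, e1, e1]; simp
      _ ≤ _ := mul_le_mul' (ENNReal.sum_le_tsum s) (ENNReal.sum_le_tsum s)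
  have h2 : Tendsto (fun s : Finset ι => (∑ i ∈ s, u i * v i) ^ 2) atTop
      (𝓝 ((∑' i, u i * v i) ^ 2)) :=
    ((ENNReal.continuous_pow 2).tendsto _).comp ENNReal.summable.hasSum
  exact le_of_tendsto h2 (Eventually.of_forall h)

theorem conv_sq_le (a ξ : Gsu A → ℂ) (L : ℝ≥0∞)
    (hx : ∀ z, ∑' η : {η : Gsu A // η.x = z}, ‖a η.1‖ₑ ≤ L)
    (hy : ∀ z, ∑' η : {η : Gsu A // η.y = z}, ‖a η.1‖ₑ ≤ L) :
    ∑' γ, ‖conv a ξ γ‖ₑ ^ 2 ≤ L ^ 2 * ∑' γ, ‖ξ γ‖ₑ ^ 2 := by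
  have h1 : ∀ γ, ‖conv a ξ γ‖ₑ ^ 2 ≤
      L * ∑' η : {η : Gsu A // η.x = γ.x}, ‖a η.1‖ₑ * ‖ξ (mul (inv η.1) γ η.2)‖ₑ ^ 2 := by
    intro γ
    have h2 : ‖conv a ξ γ‖ₑ ≤
        ∑' η : {η : Gsu A // η.x = γ.x}, ‖a η.1‖ₑ * ‖ξ (mul (inv η.1) γ η.2)‖ₑ := by
      refine enorm_tsum_le_tsum_enorm.trans (le_of_eq ?_)
      simp only [enorm_mul]
    calc ‖conv a ξ γ‖ₑ ^ 2 ≤ _ := by gcongr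
      _ ≤ _ := tsum_mul_sq_le _ _
      _ ≤ _ := by gcongr; exact hx _
  calc ∑' γ, ‖conv a ξ γ‖ₑ ^ 2
      ≤ ∑' γ : Gsu A, L * ∑' η : {η : Gsu A // η.x = γ.x},
          ‖a η.1‖ₑ * ‖ξ (mul (inv η.1) γ η.2)‖ₑ ^ 2 := ENNReal.tsum_le_tsum h1
    _ = L * ∑' z : (Σ γ : Gsu A, {η : Gsu A // η.x = γ.x}),
          ‖a z.2.1‖ₑ * ‖ξ (mul (inv z.2.1) z.1 z.2.2)‖ₑ ^ 2 := by
        rw [ENNReal.tsum_mul_left, ENNReal.tsum_sigma']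
    _ = L * ∑' z : (Σ δ : Gsu A, {η : Gsu A // η.y = δ.x}), ‖a z.2.1‖ₑ * ‖ξ z.1‖ₑ ^ 2 := by
        rw [← (reindex A).tsum_eq]; rfl
    _ = L * ∑' δ : Gsu A, (∑' η : {η : Gsu A // η.y = δ.x}, ‖a η.1‖ₑ) * ‖ξ δ‖ₑ ^ 2 := by
        rw [ENNReal.tsum_sigma']; simp only [ENNReal.tsum_mul_right]
    _ ≤ L * ∑' δ : Gsu A, L * ‖ξ δ‖ₑ ^ 2 := by
        gcongr; exact hy _
    _ = L ^ 2 * ∑' γ, ‖ξ γ‖ₑ ^ 2 := by rw [ENNReal.tsum_mul_left, ← mul_assoc, pow_two]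

end Gsu

/-- The Hilbert space `ℓ²(G_A^{s,u} ⋊ ℤ²)`, the direct sum over `x ∈ X_A` of the Hilbert spaces
`ℓ²(s⁻¹(x))` that carry the left regular representations of the groupoid. -/
abbrev L2 (A : Matrix (Fin N) (Fin N) ℤ) : Type := lp (fun _ : Gsu A => ℂ) 2

theorem memℓp_two_iff {ι : Type} (ξ : ι → ℂ) :
    Memℓp ξ 2 ↔ ∑' i, ‖ξ i‖ₑ ^ 2 ≠ ⊤ := by
  rw [memℓp_gen_iff (by norm_num)]
  have h : ∀ i, ‖ξ i‖ₑ ^ 2 = ENNReal.ofReal (‖ξ i‖ ^ (2 : ℝ≥0∞).toReal) := fun i => by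
    rw [← ofReal_norm, ← ENNReal.ofReal_pow (norm_nonneg _)]; simp
  simp only [h]
  constructor
  · intro hs
    exact hs.tsum_ofReal_ne_top
  · intro hs
    have := ENNReal.summable_toReal hs
    simpa [ENNReal.toReal_ofReal, sq_nonneg] using this

theorem tsum_enorm_sq {ι : Type} (ξ : lp (fun _ : ι => ℂ) 2) :
    ∑' i, ‖ξ i‖ₑ ^ 2 = ENNReal.ofReal (‖ξ‖ ^ 2) := by
  have h1 := lp.norm_rpow_eq_tsum (p := 2) (by norm_num) ξ
  have hs := (memℓp_gen_iff (p := 2) (by norm_num)).mp (lp.memℓp ξ)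
  simp only [ENNReal.toReal_ofNat, Real.rpow_ofNat] at h1 hs
  rw [h1, ENNReal.ofReal_tsum_of_nonneg (fun _ => by positivity) hs]
  refine tsum_congr fun i => ?_
  rw [← ofReal_norm, ← ENNReal.ofReal_pow (norm_nonneg _)]

theorem memℓp_conv (a : C_c(Gsu A, ℂ)) (ξ : L2 A) : Memℓp (Gsu.conv a ξ) 2 := by
  obtain ⟨L, hL, hx, hy⟩ := Gsu.exists_fibre_bound a
  rw [memℓp_two_iff]
  refine ne_top_of_le_ne_top ?_ (Gsu.conv_sq_le a ξ L hx hy)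
  rw [tsum_enorm_sq]
  exact ENNReal.mul_ne_top (ENNReal.pow_ne_top hL) ENNReal.ofReal_ne_top

theorem summable_conv (a : C_c(Gsu A, ℂ)) (ξ : L2 A) (γ : Gsu A) :
    Summable fun η : {η : Gsu A // η.x = γ.x} =>
      a η.1 * ξ (Gsu.mul (Gsu.inv η.1) γ η.2) := by
  obtain ⟨L, hL, hx, hy⟩ := Gsu.exists_fibre_bound a
  have h1 : Summable fun η : {η : Gsu A // η.x = γ.x} => ‖a η.1‖ := by
    have := ENNReal.summable_toReal (ne_top_of_le_ne_top hL (hx γ.x))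
    simpa using this
  refine Summable.of_norm_bounded (h1.mul_right ‖ξ‖) fun η => ?_
  rw [norm_mul]
  exact mul_le_mul_of_nonneg_left (lp.norm_apply_le_norm (by norm_num) ξ _) (norm_nonneg _)

/-- The left regular representation: `leftReg a` is the bounded operator `ξ ↦ a * ξ` on
`ℓ²(G_A^{s,u} ⋊ ℤ²)`, for `a ∈ C_c(G_A^{s,u} ⋊ ℤ²)`. -/
def leftReg (a : C_c(Gsu A, ℂ)) : L2 A →L[ℂ] L2 A :=
  LinearMap.mkContinuousOfExistsBound
    { toFun := fun ξ => ⟨Gsu.conv a ξ, memℓp_conv a ξ⟩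
      map_add' := fun ξ ζ => by
        ext γ
        simp only [Gsu.conv, lp.coeFn_add, Pi.add_apply, mul_add]
        exact (summable_conv a ξ γ).tsum_add (summable_conv a ζ γ)
      map_smul' := fun c ξ => by
        ext γ
        simp only [Gsu.conv, lp.coeFn_smul, Pi.smul_apply, smul_eq_mul, RingHom.id_apply]
        rw [← tsum_mul_left]
        exact tsum_congr fun η => by ring }
    (by
      obtain ⟨L, hL, hx, hy⟩ := Gsu.exists_fibre_bound a
      refine ⟨L.toReal, fun ξ => ?_⟩
      have h := Gsu.conv_sq_le a ξ L hx hy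
      have e := tsum_enorm_sq (⟨Gsu.conv a ξ, memℓp_conv a ξ⟩ : L2 A)
      have e' : ∑' γ, ‖Gsu.conv a ξ γ‖ₑ ^ 2 =
        ENNReal.ofReal (‖(⟨Gsu.conv a ξ, memℓp_conv a ξ⟩ : L2 A)‖ ^ 2) := e
      rw [e', tsum_enorm_sq, ← ENNReal.ofReal_toReal hL,
        ← ENNReal.ofReal_pow ENNReal.toReal_nonneg, ← ENNReal.ofReal_mul (by positivity),
        ENNReal.ofReal_le_ofReal_iff (by positivity), ← mul_pow] at h
      exact (pow_le_pow_iff_left₀ (norm_nonneg _) (by positivity) two_ne_zero).mp h)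

theorem leftReg_apply (a : C_c(Gsu A, ℂ)) (ξ : L2 A) (γ : Gsu A) :
    leftReg a ξ γ = Gsu.conv a ξ γ := rfl

/-- The extended Ruelle algebra `R̃_A = C*(G_A^{s,u} ⋊ ℤ²)`, as the reduced groupoid C*-algebra:
the C*-algebra of operators on `ℓ²(G_A^{s,u} ⋊ ℤ²)` generated by the image of
`C_c(G_A^{s,u} ⋊ ℤ²)` under the left regular representation (this image is a `*`-algebra, so that
the generated C*-algebra is its norm closure). The norm of the operator of `a` is the reduced
C*-norm of `a`, the supremum over `x ∈ X_A` of its norms on `ℓ²(s⁻¹(x))`. -/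
def extRuelle (A : Matrix (Fin N) (Fin N) ℤ) : NonUnitalStarSubalgebra ℂ (L2 A →L[ℂ] L2 A) :=
  (NonUnitalStarAlgebra.adjoin ℂ (Set.range (leftReg (A := A)))).topologicalClosure

theorem leftReg_mem (a : C_c(Gsu A, ℂ)) : leftReg a ∈ extRuelle A :=
  NonUnitalStarSubalgebra.le_topologicalClosure _
    (NonUnitalStarAlgebra.subset_adjoin ℂ _ ⟨a, rfl⟩)

/-! ### The subalgebra `C(X_A)` -/

namespace Gsu

/-- The set of units `(x, 0, 0, x)`. -/
def units (A : Matrix (Fin N) (Fin N) ℤ) : Set (Gsu A) := {g | g.x = g.y ∧ g.p = 0 ∧ g.q = 0}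

theorem units_eq_box : units A = box A 0 0 0 0 := by
  ext g
  constructor
  · rintro ⟨e, hp, hq⟩
    refine ⟨hp, hq, fun i _ => ?_, fun i _ => ?_⟩ <;> simp [shiftZ, hp, hq, e]
  · rintro ⟨hp, hq, hs, hu⟩
    refine ⟨Subtype.ext (funext fun i => ?_), hp, hq⟩
    rcases le_total 0 i with h | h
    · simpa [shiftZ, hp] using hs i (by simpa using h)
    · simpa [shiftZ, hq] using hu i (by simpa using h)

theorem isClopen_units : IsClopen (units A) := by
  constructor
  · exact (isClosed_eq continuous_x continuous_y).inter
      ((isClosed_eq continuous_p continuous_const).inter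
        (isClosed_eq continuous_q continuous_const))
  · rw [units_eq_box]; exact isOpen_box _ _ _ _

theorem continuous_diagS : Continuous fun x : ShiftSpace A => (unit x).toProd.1 := by
  refine ⟨fun U hU => ?_⟩
  obtain ⟨V, hV, hUV⟩ := isOpen_indLim.mp (show IsOpen[indLim (StableRel A) (levelS A)] U from hU) 0
  have hd : Continuous fun x : ShiftSpace A => (x, x) := continuous_id.prodMk continuous_id
  have e : ∀ x : ShiftSpace A, (unit x).toProd.1.1 = (x, x) := fun x => by
    simp [toProd, unit, shiftZ_zero]
  convert hV.preimage hd using 1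
  ext x
  refine (hUV (unit x).toProd.1 (by rw [e]; exact fun _ _ => rfl)).trans ?_
  rw [e]; rfl

theorem continuous_diagU : Continuous fun x : ShiftSpace A => (unit x).toProd.2.1 := by
  refine ⟨fun U hU => ?_⟩
  obtain ⟨V, hV, hUV⟩ :=
    isOpen_indLim.mp (show IsOpen[indLim (UnstableRel A) (levelU A)] U from hU) 0
  have hd : Continuous fun x : ShiftSpace A => (x, x) := continuous_id.prodMk continuous_id
  have e : ∀ x : ShiftSpace A, (unit x).toProd.2.1.1 = (x, x) := fun x => by
    simp [toProd, unit, shiftZ_zero]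
  convert hV.preimage hd using 1
  ext x
  refine (hUV (unit x).toProd.2.1 (by rw [e]; exact fun _ _ => rfl)).trans ?_
  rw [e]; rfl

theorem continuous_unit : Continuous (unit : ShiftSpace A → Gsu A) :=
  continuous_induced_rng.mpr <|
    continuous_diagS.prodMk (continuous_diagU.prodMk (continuous_const.prodMk continuous_const))

/-- The topology of `G_A^{s,u} ⋊ ℤ²` is Hausdorff. -/
instance instT2Gsu : T2Space (Gsu A) :=
  T2Space.of_injective_continuous (f := fun g : Gsu A => (g.x, g.p, g.q, g.y))
    (fun g h e => by
      simp only [Prod.mk.injEq] at e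
      exact Gsu.ext e.1 e.2.1 e.2.2.1 e.2.2.2)
    (continuous_x.prodMk (continuous_p.prodMk (continuous_q.prodMk continuous_y)))

theorem isCompact_units : IsCompact (units A) := by
  have : units A = Set.range (unit : ShiftSpace A → Gsu A) := by
    ext g
    constructor
    · rintro ⟨e, hp, hq⟩
      exact ⟨g.x, Gsu.ext rfl hp.symm hq.symm e⟩
    · rintro ⟨x, rfl⟩
      exact ⟨rfl, rfl, rfl⟩
  rw [this]
  exact isCompact_range continuous_unit

end Gsu

/-- A continuous function `h` on `X_A` as an element of `C_c(G_A^{s,u} ⋊ ℤ²)`: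
`(x, p, q, y) ↦ h x` if `x = y` and `p = q = 0`, and `0` otherwise. -/
def unitFun (h : C(ShiftSpace A, ℂ)) : C_c(Gsu A, ℂ) where
  toFun := (Gsu.units A).indicator fun g => h g.x
  continuous_toFun := (h.continuous.comp Gsu.continuous_x).indicator
    (fun g hg => by rw [Gsu.isClopen_units.frontier_eq] at hg; exact hg.elim)
  hasCompactSupport' := HasCompactSupport.intro Gsu.isCompact_units
    fun g hg => Set.indicator_of_notMem hg _

/-- The subalgebra `C(X_A)` of `R̃_A`. -/
def diagonal (A : Matrix (Fin N) (Fin N) ℤ) : Set (extRuelle A) :=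
  Set.range fun h : C(ShiftSpace A, ℂ) => (⟨leftReg (unitFun h), leftReg_mem _⟩ : extRuelle A)

/-! ### Gauge actions with potentials -/

/-- `fⁿ x = ∑_{i=0}^{n-1} f (σⁱ x)` for `n ≥ 1`, `f⁰ = 0`, and `fⁿ x = -∑_{i=n}^{-1} f (σⁱ x)`
for `n ≤ -1`: at most one of the two sums below is non-empty. -/
def birkhoff (f : C(ShiftSpace A, ℤ)) (n : ℤ) (x : ShiftSpace A) : ℤ :=
  ∑ i ∈ Finset.Ico 0 n, f (shiftZ i x) - ∑ i ∈ Finset.Ico n 0, f (shiftZ i x)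

theorem birkhoff_succ (f : C(ShiftSpace A, ℤ)) (n : ℤ) (x : ShiftSpace A) :
    birkhoff f (n + 1) x = birkhoff f n x + f (shiftZ n x) := by
  unfold birkhoff
  rcases le_or_gt 0 n with h | h
  · have h1 : Finset.Ico 0 (n + 1) = insert n (Finset.Ico 0 n) := by
      ext i; simp only [Finset.mem_Ico, Finset.mem_insert]; omega
    rw [h1, Finset.sum_insert (by simp), Finset.Ico_eq_empty (by omega : ¬ n + 1 < 0),
      Finset.Ico_eq_empty (by omega : ¬ n < 0)]
    simp only [Finset.sum_empty]; ring
  · have h1 : Finset.Ico n 0 = insert n (Finset.Ico (n + 1) 0) := by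
      ext i; simp only [Finset.mem_Ico, Finset.mem_insert]; omega
    rw [h1, Finset.sum_insert (by simp), Finset.Ico_eq_empty (by omega : ¬ 0 < n + 1),
      Finset.Ico_eq_empty (by omega : ¬ 0 < n)]
    simp only [Finset.sum_empty]; ring

theorem continuous_birkhoff (f : C(ShiftSpace A, ℤ)) (n : ℤ) : Continuous (birkhoff f n) := by
  unfold birkhoff
  exact (continuous_finsetSum _ fun i _ => f.continuous.comp (continuous_shiftZ i)).sub
    (continuous_finsetSum _ fun i _ => f.continuous.comp (continuous_shiftZ i))

/-- `f̃⁺ (x, p, q, y) = lim_{n → ∞} (f^{n+p} (σ x) - fⁿ (σ y))`. -/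
def cocPlus (f : C(ShiftSpace A, ℤ)) (g : Gsu A) : ℤ :=
  limUnder atTop fun n : ℤ => birkhoff f (n + g.p) (shift g.x) - birkhoff f n (shift g.y)

/-- `f̃⁻ (x, p, q, y) = lim_{n → -∞} (f^{n+q} x - fⁿ y)`. -/
def cocMinus (f : C(ShiftSpace A, ℤ)) (g : Gsu A) : ℤ :=
  limUnder atBot fun n : ℤ => birkhoff f (n + g.q) g.x - birkhoff f n g.y

/-- A continuous integer-valued function depends on finitely many coordinates. -/
theorem exists_window (f : C(ShiftSpace A, ℤ)) :
    ∃ w : ℕ, ∀ x y : ShiftSpace A, (∀ i ∈ Set.Icc (-(w : ℤ)) w, x.1 i = y.1 i) → f x = f y := by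
  by_contra! hcon
  let T : ℕ → Set (ShiftSpace A × ShiftSpace A) := fun w =>
    {z | ∀ i ∈ Set.Icc (-(w : ℤ)) w, z.1.1 i = z.2.1 i} ∩ {z | f z.1 ≠ f z.2}
  have hcl1 : IsClosed {z : ShiftSpace A × ShiftSpace A | f z.1 ≠ f z.2} :=
    (isClosed_discrete {w : ℤ × ℤ | w.1 ≠ w.2}).preimage
      ((f.continuous.comp continuous_fst).prodMk (f.continuous.comp continuous_snd))
  have hcl : ∀ w, IsClosed (T w) := by
    intro w
    refine IsClosed.inter ?_ hcl1
    have : {z : ShiftSpace A × ShiftSpace A | ∀ i ∈ Set.Icc (-(w : ℤ)) w, z.1.1 i = z.2.1 i}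
        = ⋂ i ∈ Set.Icc (-(w : ℤ)) w, {z | z.1.1 i = z.2.1 i} := by ext z; simp
    rw [this]
    exact isClosed_biInter fun i _ => isClosed_eq
      (((continuous_apply i).comp continuous_subtype_val).comp continuous_fst)
      (((continuous_apply i).comp continuous_subtype_val).comp continuous_snd)
  obtain ⟨z, hz⟩ := IsCompact.nonempty_iInter_of_sequence_nonempty_isCompact_isClosed T
    (fun w z hz => ⟨fun i hi => hz.1 i ⟨by push_cast; have := hi.1; omega,
      by push_cast; have := hi.2; omega⟩, hz.2⟩)
    (fun w => by
      obtain ⟨x, y, h1, h2⟩ := hcon w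
      exact ⟨(x, y), h1, h2⟩)
    (hcl 0).isCompact hcl
  rw [Set.mem_iInter] at hz
  refine (hz 0).2 (congrArg f (Subtype.ext (funext fun i => ?_)))
  exact (hz i.natAbs).1 i ⟨by omega, by omega⟩

theorem cocPlus_spec (f : C(ShiftSpace A, ℤ)) (n m : ℕ) :
    ∃ K : ℤ, ∀ (p q : ℤ), ∀ g ∈ Gsu.box A p q n m,
      (∀ k ≥ K, birkhoff f (k + g.p) (shift g.x) - birkhoff f k (shift g.y) =
        birkhoff f (K + p) (shift g.x) - birkhoff f K (shift g.y)) := by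
  obtain ⟨w, hw⟩ := exists_window f
  refine ⟨n + w, fun p q g hg k hk => ?_⟩
  obtain ⟨rfl, rfl, hs, -⟩ := hg
  induction k, hk using Int.leInduction with
  | base => rfl
  | succ k hk ih =>
    rw [← ih, show k + 1 + g.p = k + g.p + 1 by ring, birkhoff_succ, birkhoff_succ]
    have : f (shiftZ (k + g.p) (shift g.x)) = f (shiftZ k (shift g.y)) := by
      refine hw _ _ fun i hi => ?_
      have h1 := hs (i + k + 1) (by have := hi.1; omega)
      simp only [shift, shiftZ] at h1 ⊢
      rw [← h1]; ring_nf
    rw [this]; ring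

theorem cocMinus_spec (f : C(ShiftSpace A, ℤ)) (n m : ℕ) :
    ∃ K : ℤ, ∀ (p q : ℤ), ∀ g ∈ Gsu.box A p q n m,
      (∀ k ≤ K, birkhoff f (k + g.q) g.x - birkhoff f k g.y =
        birkhoff f (K + q) g.x - birkhoff f K g.y) := by
  obtain ⟨w, hw⟩ := exists_window f
  refine ⟨-m - w, fun p q g hg k hk => ?_⟩
  obtain ⟨rfl, rfl, -, hu⟩ := hg
  induction k, hk using Int.leInductionDown with
  | base => rfl
  | pred k hk ih =>
    have e1 := birkhoff_succ f (k - 1 + g.q) g.x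
    have e2 := birkhoff_succ f (k - 1) g.y
    rw [show k - 1 + g.q + 1 = k + g.q by ring] at e1
    rw [sub_add_cancel] at e2
    have : f (shiftZ (k - 1 + g.q) g.x) = f (shiftZ (k - 1) g.y) := by
      refine hw _ _ fun i hi => ?_
      have h1 := hu (i + (k - 1)) (by have := hi.2; omega)
      simp only [shiftZ] at h1 ⊢
      rw [← h1]; ring_nf
    rw [← ih, e1, e2, this]; ring

theorem tendsto_cocPlus (f : C(ShiftSpace A, ℤ)) (g : Gsu A) :
    Tendsto (fun n : ℤ => birkhoff f (n + g.p) (shift g.x) - birkhoff f n (shift g.y)) atTop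
      (𝓝 (cocPlus f g)) := by
  obtain ⟨n, m, hg⟩ := g.exists_mem_box
  obtain ⟨K, hK⟩ := cocPlus_spec f n m
  refine tendsto_nhds_limUnder
    ⟨birkhoff f (K + g.p) (shift g.x) - birkhoff f K (shift g.y), tendsto_const_nhds.congr' ?_⟩
  filter_upwards [eventually_ge_atTop K] with k hk using (hK _ _ g hg k hk).symm

theorem tendsto_cocMinus (f : C(ShiftSpace A, ℤ)) (g : Gsu A) :
    Tendsto (fun n : ℤ => birkhoff f (n + g.q) g.x - birkhoff f n g.y) atBot
      (𝓝 (cocMinus f g)) := by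
  obtain ⟨n, m, hg⟩ := g.exists_mem_box
  obtain ⟨K, hK⟩ := cocMinus_spec f n m
  refine tendsto_nhds_limUnder
    ⟨birkhoff f (K + g.q) g.x - birkhoff f K g.y, tendsto_const_nhds.congr' ?_⟩
  filter_upwards [eventually_le_atBot K] with k hk using (hK _ _ g hg k hk).symm

theorem continuous_cocPlus (f : C(ShiftSpace A, ℤ)) : Continuous (cocPlus f) := by
  refine continuous_iff_continuousAt.mpr fun g => ?_
  obtain ⟨n, m, hg⟩ := g.exists_mem_box
  obtain ⟨K, hK⟩ := cocPlus_spec f n m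
  have hc : Continuous fun h : Gsu A =>
      birkhoff f (K + g.p) (shift h.x) - birkhoff f K (shift h.y) :=
    ((continuous_birkhoff f _).comp ((continuous_shiftZ 1).comp Gsu.continuous_x)).sub
      ((continuous_birkhoff f _).comp ((continuous_shiftZ 1).comp Gsu.continuous_y))
  refine hc.continuousAt.congr ?_
  filter_upwards [(Gsu.isOpen_box g.p g.q n m).mem_nhds hg] with h hh
  refine tendsto_nhds_unique (tendsto_const_nhds.congr' ?_) (tendsto_cocPlus f h)
  filter_upwards [eventually_ge_atTop K] with k hk using (hK _ _ h hh k hk).symm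

theorem continuous_cocMinus (f : C(ShiftSpace A, ℤ)) : Continuous (cocMinus f) := by
  refine continuous_iff_continuousAt.mpr fun g => ?_
  obtain ⟨n, m, hg⟩ := g.exists_mem_box
  obtain ⟨K, hK⟩ := cocMinus_spec f n m
  have hc : Continuous fun h : Gsu A => birkhoff f (K + g.q) h.x - birkhoff f K h.y :=
    ((continuous_birkhoff f _).comp Gsu.continuous_x).sub
      ((continuous_birkhoff f _).comp Gsu.continuous_y)
  refine hc.continuousAt.congr ?_
  filter_upwards [(Gsu.isOpen_box g.p g.q n m).mem_nhds hg] with h hh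
  refine tendsto_nhds_unique (tendsto_const_nhds.congr' ?_) (tendsto_cocMinus f h)
  filter_upwards [eventually_le_atBot K] with k hk using (hK _ _ h hh k hk).symm

theorem cocPlus_mul (f : C(ShiftSpace A, ℤ)) (g h : Gsu A) (e : g.y = h.x) :
    cocPlus f (g.mul h e) = cocPlus f g + cocPlus f h := by
  have h1 := (tendsto_cocPlus f g).comp (tendsto_atTop_add_const_right atTop h.p tendsto_id)
  refine tendsto_nhds_unique (tendsto_cocPlus f (g.mul h e))
    ((h1.add (tendsto_cocPlus f h)).congr fun n => ?_)
  simp only [Function.comp, id, Gsu.mul, e]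
  rw [show n + h.p + g.p = n + (g.p + h.p) by ring]; ring

theorem cocMinus_mul (f : C(ShiftSpace A, ℤ)) (g h : Gsu A) (e : g.y = h.x) :
    cocMinus f (g.mul h e) = cocMinus f g + cocMinus f h := by
  have h1 := (tendsto_cocMinus f g).comp (tendsto_atBot_add_const_right atBot h.q tendsto_id)
  refine tendsto_nhds_unique (tendsto_cocMinus f (g.mul h e))
    ((h1.add (tendsto_cocMinus f h)).congr fun n => ?_)
  simp only [Function.comp, id, Gsu.mul, e]
  rw [show n + h.q + g.q = n + (g.q + h.q) by ring]; ring

/-- The function `U_{(r,s)}(f̃) (γ) = exp (2 π i (f̃⁺(γ) s + f̃⁻(γ) r))` on `G_A^{s,u} ⋊ ℤ²`, for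
`(r, s) ∈ 𝕋² = (ℝ / ℤ)²`; here `AddCircle.toCircle t = exp (2 π i t)`. -/
def phase (f : C(ShiftSpace A, ℤ)) (r s : UnitAddCircle) (γ : Gsu A) : Circle :=
  AddCircle.toCircle (cocPlus f γ • s + cocMinus f γ • r)

theorem continuous_phase (f : C(ShiftSpace A, ℤ)) (r s : UnitAddCircle) :
    Continuous (phase f r s) := by
  have h : Continuous fun z : ℤ × ℤ => (AddCircle.toCircle (z.1 • s + z.2 • r) : Circle) :=
    continuous_of_discreteTopology
  exact h.comp ((continuous_cocPlus f).prodMk (continuous_cocMinus f))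

theorem phase_mul (f : C(ShiftSpace A, ℤ)) (r s : UnitAddCircle) (g h : Gsu A) (e : g.y = h.x) :
    phase f r s (g.mul h e) = phase f r s g * phase f r s h := by
  unfold phase
  rw [cocPlus_mul, cocMinus_mul, ← AddCircle.toCircle_add]
  congr 1
  simp only [add_smul]; abel

theorem memℓp_circle_mul (u : Gsu A → Circle) (ξ : L2 A) :
    Memℓp (fun γ => (u γ : ℂ) * ξ γ) 2 := by
  rw [memℓp_two_iff]
  have := (memℓp_two_iff _).mp (lp.memℓp ξ)
  have e : ∀ γ, ‖(u γ : ℂ) * ξ γ‖ₑ = ‖ξ γ‖ₑ := fun γ => by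
    rw [← ofReal_norm, ← ofReal_norm, norm_mul, Circle.norm_coe, one_mul]
  simpa only [e] using this

/-- The unitary operator of multiplication by a function `u` with values in the unit circle. -/
def mulUnitary (u : Gsu A → Circle) : L2 A ≃ₗᵢ[ℂ] L2 A where
  toFun ξ := ⟨fun γ => (u γ : ℂ) * ξ γ, memℓp_circle_mul u ξ⟩
  invFun ξ := ⟨fun γ => ((u γ)⁻¹ : Circle) * ξ γ, memℓp_circle_mul (fun γ => (u γ)⁻¹) ξ⟩
  map_add' ξ ζ := by
    ext γ
    exact mul_add _ _ _
  map_smul' c ξ := by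
    ext γ
    exact mul_left_comm _ _ _
  left_inv ξ := by
    ext γ
    show (((u γ)⁻¹ : Circle) : ℂ) * ((u γ : ℂ) * ξ γ) = ξ γ
    rw [← mul_assoc, ← Circle.coe_mul, inv_mul_cancel, Circle.coe_one, one_mul]
  right_inv ξ := by
    ext γ
    show (u γ : ℂ) * ((((u γ)⁻¹ : Circle) : ℂ) * ξ γ) = ξ γ
    rw [← mul_assoc, ← Circle.coe_mul, mul_inv_cancel, Circle.coe_one, one_mul]
  norm_map' ξ := by
    have h1 := lp.norm_rpow_eq_tsum (p := 2) (by norm_num) ξ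
    have h2 := lp.norm_rpow_eq_tsum (p := 2) (by norm_num)
      (⟨fun γ => (u γ : ℂ) * ξ γ, memℓp_circle_mul u ξ⟩ : L2 A)
    have e : ∀ γ, ‖(u γ : ℂ) * ξ γ‖ = ‖ξ γ‖ := fun γ => by
      rw [norm_mul, Circle.norm_coe, one_mul]
    simp only [e] at h2
    rw [← h1] at h2
    simp only [ENNReal.toReal_ofNat, Real.rpow_ofNat] at h2
    exact (pow_left_inj₀ (norm_nonneg _) (norm_nonneg _) two_ne_zero).mp h2

theorem mulUnitary_apply (u : Gsu A → Circle) (ξ : L2 A) (γ : Gsu A) :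
    mulUnitary u ξ γ = (u γ : ℂ) * ξ γ := rfl

theorem mulUnitary_symm_apply (u : Gsu A → Circle) (ξ : L2 A) (γ : Gsu A) :
    (mulUnitary u).symm ξ γ = ((u γ)⁻¹ : Circle) * ξ γ := rfl

/-- `U_{(r,s)}(f̃)` as a unitary operator on `ℓ²(G_A^{s,u} ⋊ ℤ²)`:
`[U_{(r,s)}(f̃) ξ](γ) = exp (2 π i (f̃⁺(γ) s + f̃⁻(γ) r)) ξ(γ)`. -/
def gaugeUnitary (f : C(ShiftSpace A, ℤ)) (r s : UnitAddCircle) : unitary (L2 A →L[ℂ] L2 A) :=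
  Unitary.linearIsometryEquiv.symm (mulUnitary (phase f r s))

/-- `Ad (U_{(r,s)}(f̃))` on all bounded operators: `T ↦ U_{(r,s)}(f̃) T U_{(r,s)}(f̃)*`. -/
def gaugeAd (f : C(ShiftSpace A, ℤ)) (r s : UnitAddCircle) :
    (L2 A →L[ℂ] L2 A) ≃⋆ₐ[ℂ] (L2 A →L[ℂ] L2 A) :=
  Unitary.conjStarAlgAut ℂ _ (gaugeUnitary f r s)

theorem gaugeAd_apply_apply (f : C(ShiftSpace A, ℤ)) (r s : UnitAddCircle) (T : L2 A →L[ℂ] L2 A)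
    (ξ : L2 A) : gaugeAd f r s T ξ =
      mulUnitary (phase f r s) (T ((mulUnitary (phase f r s)).symm ξ)) := by
  unfold gaugeAd gaugeUnitary
  rw [Unitary.conjStarAlgAut_symm_unitaryLinearIsometryEquiv]
  rfl

/-- The pointwise product of `U_{(r,s)}(f̃)` and `a ∈ C_c(G_A^{s,u} ⋊ ℤ²)`. -/
def phaseMul (f : C(ShiftSpace A, ℤ)) (r s : UnitAddCircle) (a : C_c(Gsu A, ℂ)) :
    C_c(Gsu A, ℂ) where
  toFun γ := (phase f r s γ : ℂ) * a γ
  continuous_toFun := ((by fun_prop : Continuous fun c : Circle => (c : ℂ)).comp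
    (continuous_phase f r s)).mul a.continuous
  hasCompactSupport' := a.hasCompactSupport.mul_left

theorem gaugeAd_leftReg (f : C(ShiftSpace A, ℤ)) (r s : UnitAddCircle) (a : C_c(Gsu A, ℂ)) :
    gaugeAd f r s (leftReg a) = leftReg (phaseMul f r s a) := by
  ext ξ γ
  rw [gaugeAd_apply_apply, mulUnitary_apply, leftReg_apply, leftReg_apply]
  unfold Gsu.conv
  rw [← tsum_mul_left]
  refine tsum_congr fun η => ?_
  rw [mulUnitary_symm_apply]
  have hγ : phase f r s γ = phase f r s η.1 * phase f r s (Gsu.mul (Gsu.inv η.1) γ η.2) := by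
    rw [← phase_mul f r s η.1 (Gsu.mul (Gsu.inv η.1) γ η.2) rfl]
    congr 1
    apply Gsu.ext <;> simp [Gsu.mul, Gsu.inv, η.2]
  have hv : phase f r s γ * (phase f r s (Gsu.mul (Gsu.inv η.1) γ η.2))⁻¹ = phase f r s η.1 := by
    rw [hγ, mul_inv_cancel_right]
  have hc := congrArg (fun c : Circle => (c : ℂ)) hv
  simp only [Circle.coe_mul] at hc
  show (phase f r s γ : ℂ) * (a η.1 * (_ * _)) = ((phase f r s η.1 : ℂ) * a η.1) * _
  rw [← hc]
  ring

theorem continuous_gaugeAd (f : C(ShiftSpace A, ℤ)) (r s : UnitAddCircle) :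
    Continuous (gaugeAd f r s) := by
  show Continuous fun T : L2 A →L[ℂ] L2 A =>
    (gaugeUnitary f r s : L2 A →L[ℂ] L2 A) * T * (star (gaugeUnitary f r s) : L2 A →L[ℂ] L2 A)
  fun_prop

theorem gaugeAd_mem (f : C(ShiftSpace A, ℤ)) (r s : UnitAddCircle) {T : L2 A →L[ℂ] L2 A}
    (hT : T ∈ extRuelle A) : gaugeAd f r s T ∈ extRuelle A := by
  have h : extRuelle A ≤ (extRuelle A).comap (gaugeAd f r s) := by
    refine NonUnitalStarSubalgebra.topologicalClosure_minimal _ ?_ ?_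
    · refine NonUnitalStarAlgebra.adjoin_le ?_
      rintro _ ⟨a, rfl⟩
      show gaugeAd f r s (leftReg a) ∈ extRuelle A
      rw [gaugeAd_leftReg]
      exact leftReg_mem _
    · exact (NonUnitalStarSubalgebra.isClosed_topologicalClosure _).preimage
        (continuous_gaugeAd f r s)
  exact h hT

theorem gaugeAd_neg (f : C(ShiftSpace A, ℤ)) (r s : UnitAddCircle) (T : L2 A →L[ℂ] L2 A) :
    gaugeAd f (-r) (-s) (gaugeAd f r s T) = T := by
  have hph : ∀ γ, phase f (-r) (-s) γ = (phase f r s γ)⁻¹ := fun γ => by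
    unfold phase
    rw [← AddCircle.toCircle_neg]
    congr 1
    simp only [smul_neg]; abel
  have h1 : ∀ ξ : L2 A, mulUnitary (phase f (-r) (-s)) ξ = (mulUnitary (phase f r s)).symm ξ := by
    intro ξ
    ext γ
    rw [mulUnitary_apply, mulUnitary_symm_apply, hph]
  have h2 : ∀ ξ : L2 A, (mulUnitary (phase f (-r) (-s))).symm ξ = mulUnitary (phase f r s) ξ := by
    intro ξ
    ext γ
    rw [mulUnitary_apply, mulUnitary_symm_apply, hph, inv_inv]
  ext1 ξ
  rw [gaugeAd_apply_apply, gaugeAd_apply_apply, h1, h2]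
  simp

/-- The automorphism `γ^{A,f}_{(r,s)}` of `R̃_A`: the restriction of `Ad (U_{(r,s)}(f̃))`. -/
def gaugeAction (f : C(ShiftSpace A, ℤ)) (r s : UnitAddCircle) :
    extRuelle A ≃⋆ₐ[ℂ] extRuelle A where
  toFun a := ⟨gaugeAd f r s a, gaugeAd_mem f r s a.2⟩
  invFun a := ⟨gaugeAd f (-r) (-s) a, gaugeAd_mem f (-r) (-s) a.2⟩
  left_inv a := Subtype.ext (gaugeAd_neg f r s a)
  right_inv a := Subtype.ext (by
    have h := gaugeAd_neg f (-r) (-s) (a : L2 A →L[ℂ] L2 A)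
    rwa [neg_neg, neg_neg] at h)
  map_mul' a b := Subtype.ext (map_mul (gaugeAd f r s) _ _)
  map_add' a b := Subtype.ext (map_add (gaugeAd f r s) _ _)
  map_star' a := Subtype.ext (map_star (gaugeAd f r s) _)
  map_smul' c a := Subtype.ext (map_smul (gaugeAd f r s) c _)

end MarkovShift

end

/-!
A topological conjugacy `φ` is a sliding block code, so that `φ × φ` moves the levels of the
inductive limits defining `G^s` and `G^u` by a bounded amount only. Hence
`(x, p, q, y) ↦ (φ x, p, q, φ y)` is an isomorphism of topological groupoids. Such an isomorphism
`Ψ` permutes the canonical basis of `ℓ²`, and conjugation by the resulting unitary carries the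
convolution operator of `a` to that of `a ∘ Ψ⁻¹`. Functions on the unit space are thereby carried
to functions on the unit space, and multiplication by `v ∘ Ψ` to multiplication by `v`. As
`f = g ∘ φ` makes the Birkhoff sums of `f` and `g` correspond, the latter applies to the phases
which implement the two gauge actions.
-/

noncomputable section

open Function
open scoped ENNReal CompactlySupported

namespace MarkovShift

section Reindex

variable {ι κ E : Type*} [NormedAddCommGroup E] {p : ℝ≥0∞}

theorem memℓp_comp_equiv (e : ι ≃ κ) {ξ : κ → E} (hξ : Memℓp ξ p) : Memℓp (ξ ∘ e) p := by
  rcases p.trichotomy with rfl | rfl | hp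
  · exact memℓp_zero ((memℓp_zero_iff.mp hξ).preimage e.injective.injOn)
  · exact memℓp_infty ((memℓp_infty_iff.mp hξ).mono (Set.range_comp_subset_range e (‖ξ ·‖)))
  · exact (memℓp_gen_iff hp).mpr (((memℓp_gen_iff hp).mp hξ).comp_injective e.injective)

theorem norm_eq_of_comp_equiv (e : ι ≃ κ) [Fact (1 ≤ p)] (ξ : lp (fun _ : ι => E) p)
    (ζ : lp (fun _ : κ => E) p) (h : ∀ i, ξ i = ζ (e i)) : ‖ξ‖ = ‖ζ‖ := by
  rcases p.trichotomy with rfl | rfl | hp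
  · exact absurd (Fact.out : (1 : ℝ≥0∞) ≤ 0) (by simp)
  · simp only [lp.norm_eq_ciSup, h]
    exact e.iSup_comp (g := fun k => ‖ζ k‖)
  · simp only [lp.norm_eq_tsum_rpow hp, h]
    rw [e.tsum_eq fun k => ‖ζ k‖ ^ p.toReal]

/-- The isometric isomorphism `ξ ↦ ξ ∘ e⁻¹` of `ℓᵖ` spaces induced by a bijection `e` of the index
sets. -/
def lpReindex (𝕜 : Type*) [NormedRing 𝕜] [Module 𝕜 E] [IsBoundedSMul 𝕜 E] [Fact (1 ≤ p)]
    (e : ι ≃ κ) : lp (fun _ : ι => E) p ≃ₗᵢ[𝕜] lp (fun _ : κ => E) p where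
  toFun ξ := ⟨ξ ∘ e.symm, memℓp_comp_equiv e.symm (lp.memℓp ξ)⟩
  invFun ξ := ⟨ξ ∘ e, memℓp_comp_equiv e (lp.memℓp ξ)⟩
  map_add' _ _ := rfl
  map_smul' _ _ := rfl
  left_inv ξ := lp.ext (funext fun i => congrArg ξ (e.symm_apply_apply i))
  right_inv ξ := lp.ext (funext fun k => congrArg ξ (e.apply_symm_apply k))
  norm_map' ξ := norm_eq_of_comp_equiv e.symm _ ξ fun _ => rfl

end Reindex

theorem continuous_indLim_map {Y Z : Type} [TopologicalSpace Y] [TopologicalSpace Z]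
    {S : Set Y} {T : Set Z} {E : ℕ → Set Y} {F : ℕ → Set Z} {u : Y → Z} (hu : Continuous u)
    (hST : Set.MapsTo u S T) {w : ℕ} (hEF : ∀ n, Set.MapsTo u (E n) (F (n + w))) :
    @Continuous S T (indLim S E) (indLim T F) (hST.restrict u S T) := by
  refine @Continuous.mk _ _ (indLim S E) (indLim T F) _ fun U hU => isOpen_indLim.mpr fun n => ?_
  obtain ⟨V, hV, hUV⟩ := isOpen_indLim.mp hU (n + w)
  exact ⟨u ⁻¹' V, hV.preimage hu, fun z hz => hUV (hST.restrict u S T z) (hEF n hz)⟩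

variable {N M : ℕ} {A : Matrix (Fin N) (Fin N) ℤ} {B : Matrix (Fin M) (Fin M) ℤ}

section BlockCode

theorem shiftZ_add (m n : ℤ) :
    (shiftZ (m + n) : ShiftSpace A → ShiftSpace A) = shiftZ m ∘ shiftZ n :=
  funext fun x => (shiftZ_shiftZ m n x).symm

theorem semiconj_shiftZ {φ : ShiftSpace A → ShiftSpace B} (hφ : Semiconj φ shift shift) (n : ℤ) :
    Semiconj φ (shiftZ n) (shiftZ n) := by
  have shiftZ_cancel {L : ℕ} {C : Matrix (Fin L) (Fin L) ℤ} {m n : ℤ} (h : m + n = 0)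
      (x : ShiftSpace C) : shiftZ m (shiftZ n x) = x := by
    rw [shiftZ_shiftZ, h, shiftZ_zero]
  have hφ_neg : Semiconj φ (shiftZ (-1)) (shiftZ (-1)) :=
    hφ.inverses_right (shiftZ_cancel (by norm_num)) (shiftZ_cancel (by norm_num))
  induction n with
  | zero => exact fun x => by rw [shiftZ_zero, shiftZ_zero]
  | succ n ih =>
    rw [shiftZ_add, shiftZ_add]
    exact ih.comp_right hφ
  | pred n ih =>
    rw [sub_eq_add_neg, shiftZ_add, shiftZ_add]
    exact ih.comp_right hφ_neg

/-- `φ` is a sliding block code of radius `w`: the `k`-th coordinate of `φ x` depends only on the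
coordinates of `x` at distance at most `w` from `k`. -/
def IsBlockCode (φ : ShiftSpace A → ShiftSpace B) (w : ℕ) : Prop :=
  ∀ (x y : ShiftSpace A) (k : ℤ),
    (∀ i ∈ Set.Icc (k - w) (k + w), x.1 i = y.1 i) → (φ x).1 k = (φ y).1 k

theorem exists_isBlockCode (φ : C(ShiftSpace A, ShiftSpace B)) (hφ : Semiconj φ shift shift) :
    ∃ w, IsBlockCode φ w := by
  let symbol₀ : C(ShiftSpace A, ℤ) :=
    ⟨fun x => ((φ x).1 0 : ℕ), (continuous_of_discreteTopology (f := fun j : Fin M => (j : ℤ))).comp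
      ((continuous_apply 0).comp (continuous_subtype_val.comp φ.continuous))⟩
  obtain ⟨w, hw⟩ := exists_window symbol₀
  refine ⟨w, fun x y k hxy => ?_⟩
  have symbol₀_shift (z : ShiftSpace A) : symbol₀ (shiftZ k z) = ((φ z).1 k : ℕ) := by
    change (((φ (shiftZ k z)).1 0 : ℕ) : ℤ) = _
    rw [(semiconj_shiftZ hφ k).eq]
    simp [shiftZ]
  have h : symbol₀ (shiftZ k x) = symbol₀ (shiftZ k y) :=
    hw _ _ fun i hi => hxy (i + k) ⟨by linarith [hi.1], by linarith [hi.2]⟩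
  rw [symbol₀_shift, symbol₀_shift, Nat.cast_inj] at h
  exact Fin.ext h

variable {φ : ShiftSpace A → ShiftSpace B} {w : ℕ}

theorem IsBlockCode.mapsTo_levelS (hw : IsBlockCode φ w) (n : ℕ) :
    Set.MapsTo (Prod.map φ φ) (levelS A n) (levelS B (n + w)) := fun _ hz k hk =>
  hw _ _ k fun i hi => hz i (by push_cast at hk; linarith [hi.1])

theorem IsBlockCode.mapsTo_levelU (hw : IsBlockCode φ w) (n : ℕ) :
    Set.MapsTo (Prod.map φ φ) (levelU A n) (levelU B (n + w)) := fun _ hz k hk =>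
  hw _ _ k fun i hi => hz i (by push_cast at hk; linarith [hi.2])

theorem IsBlockCode.mapsTo_stableRel (hw : IsBlockCode φ w) :
    Set.MapsTo (Prod.map φ φ) (StableRel A) (StableRel B) := by
  rw [stableRel_eq_iUnion, stableRel_eq_iUnion, Set.mapsTo_iUnion]
  exact fun n => (hw.mapsTo_levelS n).mono_right (Set.subset_iUnion _ _)

theorem IsBlockCode.mapsTo_unstableRel (hw : IsBlockCode φ w) :
    Set.MapsTo (Prod.map φ φ) (UnstableRel A) (UnstableRel B) := by
  rw [unstableRel_eq_iUnion, unstableRel_eq_iUnion, Set.mapsTo_iUnion]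
  exact fun n => (hw.mapsTo_levelU n).mono_right (Set.subset_iUnion _ _)

end BlockCode

theorem birkhoff_comp {φ : C(ShiftSpace A, ShiftSpace B)} (hφ : Semiconj φ shift shift)
    (g : C(ShiftSpace B, ℤ)) (n : ℤ) (x : ShiftSpace A) :
    birkhoff (g.comp φ) n x = birkhoff g n (φ x) := by
  simp only [birkhoff, ContinuousMap.comp_apply, (semiconj_shiftZ hφ _).eq]

namespace Gsu

theorem mul_inv_mul_cancel (g k : Gsu A) (e : g.x = k.x) : g.mul ((inv g).mul k e) rfl = k :=
  Gsu.ext e (add_neg_cancel_left _ _) (add_neg_cancel_left _ _) rfl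

theorem inv_mul_mul_cancel (g h : Gsu A) (e : g.y = h.x) : (inv g).mul (g.mul h e) rfl = h :=
  Gsu.ext e (neg_add_cancel_left _ _) (neg_add_cancel_left _ _) rfl

theorem mem_units_iff_mul_self {g : Gsu A} : g ∈ units A ↔ ∃ e : g.y = g.x, g.mul g e = g := by
  constructor
  · rintro ⟨hxy, hp, hq⟩
    exact ⟨hxy.symm, Gsu.ext rfl (by simp [mul, hp]) (by simp [mul, hq]) rfl⟩
  · rintro ⟨hyx, hmul⟩
    exact ⟨hyx.symm, add_eq_left.mp (congrArg p hmul), add_eq_left.mp (congrArg q hmul)⟩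

/-- Isomorphisms of the topological groupoids `G_A^{s,u} ⋊ ℤ²` and `G_B^{s,u} ⋊ ℤ²`. The induced
homeomorphism `base` of the unit spaces is part of the data, and `map_x` and `map_y` say that the
isomorphism covers it. -/
structure Iso (A : Matrix (Fin N) (Fin N) ℤ) (B : Matrix (Fin M) (Fin M) ℤ) where
  toHomeomorph : Gsu A ≃ₜ Gsu B
  base : ShiftSpace A ≃ₜ ShiftSpace B
  map_x : ∀ g, (toHomeomorph g).x = base g.x
  map_y : ∀ g, (toHomeomorph g).y = base g.y
  map_mul : ∀ (g h : Gsu A) (e : g.y = h.x),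
    toHomeomorph (g.mul h e) = (toHomeomorph g).mul (toHomeomorph h) (by rw [map_y, map_x, e])

namespace Iso

instance : CoeFun (Iso A B) fun _ => Gsu A → Gsu B := ⟨fun Ψ => Ψ.toHomeomorph⟩

/-- The inverse of an isomorphism of topological groupoids. -/
def symm (Ψ : Iso A B) : Iso B A where
  toHomeomorph := Ψ.toHomeomorph.symm
  base := Ψ.base.symm
  map_x g := by rw [Ψ.base.eq_symm_apply, ← Ψ.map_x, Homeomorph.apply_symm_apply]
  map_y g := by rw [Ψ.base.eq_symm_apply, ← Ψ.map_y, Homeomorph.apply_symm_apply]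
  map_mul g h e := by
    simp only [Homeomorph.symm_apply_eq, Ψ.map_mul, Homeomorph.apply_symm_apply]

variable (Ψ : Iso A B)

theorem map_inv_mul (g k : Gsu A) (e : g.x = k.x) :
    Ψ ((inv g).mul k e) = (inv (Ψ g)).mul (Ψ k) (by simp only [inv, Ψ.map_x, e]) := by
  have hk : (Ψ g).mul (Ψ ((inv g).mul k e)) (by rw [Ψ.map_x, Ψ.map_y]; rfl) = Ψ k := by
    rw [← Ψ.map_mul g _ rfl, mul_inv_mul_cancel]
  simp only [← hk, inv_mul_mul_cancel]

theorem preimage_units : Ψ ⁻¹' units B = units A := by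
  ext g
  have composable : (Ψ g).y = (Ψ g).x ↔ g.y = g.x := by
    rw [Ψ.map_x, Ψ.map_y, Ψ.base.injective.eq_iff]
  have idempotent (e : g.y = g.x) :
      (Ψ g).mul (Ψ g) (composable.mpr e) = Ψ g ↔ g.mul g e = g := by
    rw [← Ψ.map_mul, Ψ.toHomeomorph.injective.eq_iff]
  rw [Set.mem_preimage, mem_units_iff_mul_self, mem_units_iff_mul_self]
  exact exists_prop_congr (fun e => idempotent (composable.mp e)) composable

theorem conv_map (a ξ : Gsu B → ℂ) (γ : Gsu A) : conv a ξ (Ψ γ) = conv (a ∘ Ψ) (ξ ∘ Ψ) γ := by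
  have fibre (η : Gsu A) : η.x = γ.x ↔ (Ψ η).x = (Ψ γ).x := by
    rw [Ψ.map_x, Ψ.map_x, Ψ.base.injective.eq_iff]
  rw [conv, ← (Ψ.toHomeomorph.toEquiv.subtypeEquiv fibre).tsum_eq]
  refine tsum_congr fun η => ?_
  rw [comp_apply, comp_apply, map_inv_mul]
  rfl

/-- The unitary `ξ ↦ ξ ∘ Ψ⁻¹` from `ℓ²(G_A^{s,u} ⋊ ℤ²)` to `ℓ²(G_B^{s,u} ⋊ ℤ²)`. -/
def l2Unitary : L2 A ≃ₗᵢ[ℂ] L2 B := lpReindex ℂ Ψ.toHomeomorph.toEquiv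

/-- The transport `a ↦ a ∘ Ψ⁻¹` from `C_c(G_A^{s,u} ⋊ ℤ²)` to `C_c(G_B^{s,u} ⋊ ℤ²)`. -/
def pushforward (a : C_c(Gsu A, ℂ)) : C_c(Gsu B, ℂ) := a.comp Ψ.symm.toHomeomorph.toCocompactMap

theorem conj_leftReg (a : C_c(Gsu A, ℂ)) :
    Ψ.l2Unitary.conjStarAlgEquiv (leftReg a) = leftReg (Ψ.pushforward a) := by
  ext ξ γ
  have hξ : (ξ ∘ Ψ) ∘ Ψ.symm = ξ := funext fun δ => congrArg ξ (Ψ.toHomeomorph.apply_symm_apply δ)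
  calc Ψ.l2Unitary.conjStarAlgEquiv (leftReg a) ξ γ
      = conv a (ξ ∘ Ψ) (Ψ.symm γ) := rfl
    _ = conv (a ∘ Ψ.symm) ((ξ ∘ Ψ) ∘ Ψ.symm) γ := Ψ.symm.conv_map a (ξ ∘ Ψ) γ
    _ = leftReg (Ψ.pushforward a) ξ γ := by rw [hξ]; rfl

theorem conj_mem_extRuelle {T : L2 A →L[ℂ] L2 A} (hT : T ∈ extRuelle A) :
    Ψ.l2Unitary.conjStarAlgEquiv T ∈ extRuelle B := by
  have conj_continuous : Continuous Ψ.l2Unitary.conjStarAlgEquiv :=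
    Ψ.l2Unitary.toContinuousLinearEquiv.conjContinuousAlgEquiv.continuous
  suffices extRuelle A ≤ (extRuelle B).comap Ψ.l2Unitary.conjStarAlgEquiv from this hT
  refine NonUnitalStarSubalgebra.topologicalClosure_minimal _ (NonUnitalStarAlgebra.adjoin_le ?_)
    ((NonUnitalStarSubalgebra.isClosed_topologicalClosure _).preimage conj_continuous)
  rintro _ ⟨a, rfl⟩
  have hmem := leftReg_mem (Ψ.pushforward a)
  rwa [← conj_leftReg] at hmem

/-- The isomorphism `R̃_A ≅ R̃_B` induced by an isomorphism of topological groupoids. -/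
def extRuelleCongr : extRuelle A ≃⋆ₐ[ℂ] extRuelle B where
  toFun T := ⟨Ψ.l2Unitary.conjStarAlgEquiv T, Ψ.conj_mem_extRuelle T.2⟩
  invFun T := ⟨Ψ.l2Unitary.conjStarAlgEquiv.symm T, Ψ.symm.conj_mem_extRuelle T.2⟩
  left_inv _ := Subtype.ext (Ψ.l2Unitary.conjStarAlgEquiv.symm_apply_apply _)
  right_inv _ := Subtype.ext (Ψ.l2Unitary.conjStarAlgEquiv.apply_symm_apply _)
  map_mul' _ _ := Subtype.ext (_root_.map_mul Ψ.l2Unitary.conjStarAlgEquiv _ _)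
  map_add' _ _ := Subtype.ext (map_add Ψ.l2Unitary.conjStarAlgEquiv _ _)
  map_star' _ := Subtype.ext (map_star Ψ.l2Unitary.conjStarAlgEquiv _)
  map_smul' c _ := Subtype.ext (map_smul Ψ.l2Unitary.conjStarAlgEquiv c _)

theorem pushforward_unitFun (h : C(ShiftSpace A, ℂ)) :
    Ψ.pushforward (unitFun h) = unitFun (h.comp Ψ.symm.base) :=
  DFunLike.coe_injective <|
    calc (units A).indicator (fun g => h g.x) ∘ Ψ.symm
        = (Ψ.symm ⁻¹' units A).indicator fun γ => h (Ψ.symm γ).x :=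
          funext fun _ => (Set.indicator_comp_right _).symm
      _ = (units B).indicator fun γ => h (Ψ.symm.base γ.x) := by
          simp only [Ψ.symm.preimage_units, Ψ.symm.map_x]

theorem image_diagonal : Ψ.extRuelleCongr '' diagonal A = diagonal B := by
  have map_unitFun (h : C(ShiftSpace A, ℂ)) :
      Ψ.extRuelleCongr ⟨leftReg (unitFun h), leftReg_mem _⟩ =
        ⟨leftReg (unitFun (h.comp Ψ.symm.base)), leftReg_mem _⟩ :=
    Subtype.ext ((Ψ.conj_leftReg _).trans (by rw [pushforward_unitFun]))
  have comp_surjective : Surjective fun h : C(ShiftSpace A, ℂ) =>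
      h.comp (Ψ.symm.base : C(ShiftSpace B, ShiftSpace A)) := fun h =>
    ⟨h.comp Ψ.base, ContinuousMap.ext fun x => congrArg h (Ψ.base.apply_symm_apply x)⟩
  calc Ψ.extRuelleCongr '' diagonal A
      = Set.range fun h : C(ShiftSpace A, ℂ) =>
          Ψ.extRuelleCongr ⟨leftReg (unitFun h), leftReg_mem _⟩ := (Set.range_comp _ _).symm
    _ = Set.range fun h : C(ShiftSpace A, ℂ) =>
          (⟨leftReg (unitFun (h.comp Ψ.symm.base)), leftReg_mem _⟩ : extRuelle B) :=
        congrArg Set.range (funext map_unitFun)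
    _ = diagonal B := comp_surjective.range_comp fun h =>
        (⟨leftReg (unitFun h), leftReg_mem _⟩ : extRuelle B)

theorem mulUnitary_trans_l2Unitary (v : Gsu B → Circle) :
    (mulUnitary (v ∘ Ψ)).trans Ψ.l2Unitary = Ψ.l2Unitary.trans (mulUnitary v) := by
  ext ξ γ
  exact congrArg (fun δ => (v δ : ℂ) * ξ (Ψ.symm γ)) (Ψ.toHomeomorph.apply_symm_apply γ)

theorem extRuelleCongr_gaugeAction {f : C(ShiftSpace A, ℤ)} {g : C(ShiftSpace B, ℤ)}
    {r s : UnitAddCircle} (hfg : phase g r s ∘ Ψ = phase f r s) (T : extRuelle A) :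
    Ψ.extRuelleCongr (gaugeAction f r s T) = gaugeAction g r s (Ψ.extRuelleCongr T) := by
  have conj_comm : (gaugeAd f r s).trans Ψ.l2Unitary.conjStarAlgEquiv =
      Ψ.l2Unitary.conjStarAlgEquiv.trans (gaugeAd g r s) := by
    simp only [gaugeAd, gaugeUnitary, Unitary.conjStarAlgAut_symm_unitaryLinearIsometryEquiv,
      ← LinearIsometryEquiv.conjStarAlgEquiv_trans, ← hfg, mulUnitary_trans_l2Unitary]
  exact Subtype.ext (DFunLike.congr_fun conj_comm T.1)

end Iso

section Functoriality

variable (φ : C(ShiftSpace A, ShiftSpace B)) (hφ : Semiconj φ shift shift)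

/-- The groupoid homomorphism `(x, p, q, y) ↦ (φ x, p, q, φ y)` induced by a continuous map `φ`
that commutes with the shifts. -/
def map (g : Gsu A) : Gsu B where
  x := φ g.x
  p := g.p
  q := g.q
  y := φ g.y
  stable := by
    obtain ⟨w, hw⟩ := exists_isBlockCode φ hφ
    rw [← (semiconj_shiftZ hφ g.p).eq]
    exact hw.mapsTo_stableRel (x := (shiftZ g.p g.x, g.y)) g.stable
  unstable := by
    obtain ⟨w, hw⟩ := exists_isBlockCode φ hφ
    rw [← (semiconj_shiftZ hφ g.q).eq]
    exact hw.mapsTo_unstableRel (x := (shiftZ g.q g.x, g.y)) g.unstable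

theorem continuous_map : Continuous (Gsu.map φ hφ) := by
  obtain ⟨w, hw⟩ := exists_isBlockCode φ hφ
  have hφφ : Continuous (Prod.map φ φ) := φ.continuous.prodMap φ.continuous
  let mapS : Gs A → Gs B := hw.mapsTo_stableRel.restrict (Prod.map φ φ) _ _
  have hS : Continuous mapS := continuous_indLim_map hφφ hw.mapsTo_stableRel hw.mapsTo_levelS
  let mapU : Gu A → Gu B := hw.mapsTo_unstableRel.restrict (Prod.map φ φ) _ _
  have hU : Continuous mapU := continuous_indLim_map hφφ hw.mapsTo_unstableRel hw.mapsTo_levelU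
  have toProd_map : (toProd ∘ Gsu.map φ hφ : Gsu A → _) =
      fun g => (mapS g.toProd.1, mapU g.toProd.2.1, g.p, g.q) := funext fun g =>
    Prod.ext (Subtype.ext (Prod.ext (semiconj_shiftZ hφ g.p g.x).symm rfl)) <|
    Prod.ext (Subtype.ext (Prod.ext (semiconj_shiftZ hφ g.q g.x).symm rfl)) rfl
  rw [continuous_induced_rng, toProd_map]
  exact (hS.comp continuous_toGs).prodMk <| (hU.comp continuous_toGu).prodMk <|
    continuous_p.prodMk continuous_q

variable (g : C(ShiftSpace B, ℤ))

theorem cocPlus_map (γ : Gsu A) : cocPlus g (Gsu.map φ hφ γ) = cocPlus (g.comp φ) γ := by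
  simp only [cocPlus, birkhoff_comp hφ, hφ.eq, Gsu.map]

theorem cocMinus_map (γ : Gsu A) : cocMinus g (Gsu.map φ hφ γ) = cocMinus (g.comp φ) γ := by
  simp only [cocMinus, birkhoff_comp hφ, Gsu.map]

theorem phase_map (r s : UnitAddCircle) (γ : Gsu A) :
    phase g r s (Gsu.map φ hφ γ) = phase (g.comp φ) r s γ := by
  simp only [phase, cocPlus_map φ hφ, cocMinus_map φ hφ]

end Functoriality

/-- The isomorphism `(x, p, q, y) ↦ (φ x, p, q, φ y)` of topological groupoids induced by a
topological conjugacy `φ`. -/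
def isoOfConj (φ : ShiftSpace A ≃ₜ ShiftSpace B) (hφ : Semiconj φ shift shift) : Iso A B :=
  have hφ' : Semiconj φ.symm shift shift := hφ.inverse_left φ.left_inv φ.right_inv
  { toHomeomorph :=
    { toFun := Gsu.map φ hφ
      invFun := Gsu.map φ.symm hφ'
      left_inv := fun _ => Gsu.ext (φ.symm_apply_apply _) rfl rfl (φ.symm_apply_apply _)
      right_inv := fun _ => Gsu.ext (φ.apply_symm_apply _) rfl rfl (φ.apply_symm_apply _)
      continuous_toFun := continuous_map (φ : C(ShiftSpace A, ShiftSpace B)) hφ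
      continuous_invFun := continuous_map (φ.symm : C(ShiftSpace B, ShiftSpace A)) hφ' }
    base := φ
    map_x := fun _ => rfl
    map_y := fun _ => rfl
    map_mul := fun _ _ _ => rfl }

theorem phase_comp_isoOfConj (φ : ShiftSpace A ≃ₜ ShiftSpace B) (hφ : Semiconj φ shift shift)
    (g : C(ShiftSpace B, ℤ)) (r s : UnitAddCircle) :
    phase g r s ∘ isoOfConj φ hφ = phase (g.comp φ) r s :=
  funext fun γ => phase_map (φ : C(ShiftSpace A, ShiftSpace B)) hφ g r s γ

end Gsu

end MarkovShift

end

theorem proposition5p4_general {N M : ℕ}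
    {A : Matrix (Fin N) (Fin N) ℤ} {B : Matrix (Fin M) (Fin M) ℤ}
    (φ : MarkovShift.ShiftSpace A ≃ₜ MarkovShift.ShiftSpace B)
    (hφ : ∀ x, φ (MarkovShift.shift x) = MarkovShift.shift (φ x))
    (f : C(MarkovShift.ShiftSpace A, ℤ)) (g : C(MarkovShift.ShiftSpace B, ℤ))
    (hfg : ∀ x, f x = g (φ x)) :
    ∃ Φ : MarkovShift.extRuelle A ≃⋆ₐ[ℂ] MarkovShift.extRuelle B,
      Φ '' MarkovShift.diagonal A = MarkovShift.diagonal B ∧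
      ∀ (r s : UnitAddCircle) (a : MarkovShift.extRuelle A),
        Φ (MarkovShift.gaugeAction f r s a) = MarkovShift.gaugeAction g r s (Φ a) := by
  obtain rfl : f = g.comp φ := ContinuousMap.ext hfg
  let Ψ : MarkovShift.Gsu.Iso A B := MarkovShift.Gsu.isoOfConj φ hφ
  exact ⟨Ψ.extRuelleCongr, Ψ.image_diagonal, fun r s =>
    Ψ.extRuelleCongr_gaugeAction (MarkovShift.Gsu.phase_comp_isoOfConj φ hφ g r s)⟩

theorem proposition5p4 {N M : ℕ}
    (A : Matrix (Fin N) (Fin N) ℤ) (B : Matrix (Fin M) (Fin M) ℤ)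
    (hA01 : ∀ i j, A i j = 0 ∨ A i j = 1) (hAirr : A.IsIrreducible)
    (hAperm : ∀ π : Equiv.Perm (Fin N), A ≠ π.permMatrix ℤ)
    (hB01 : ∀ i j, B i j = 0 ∨ B i j = 1) (hBirr : B.IsIrreducible)
    (hBperm : ∀ π : Equiv.Perm (Fin M), B ≠ π.permMatrix ℤ)
    (φ : MarkovShift.ShiftSpace A ≃ₜ MarkovShift.ShiftSpace B)
    (hφ : ∀ x, φ (MarkovShift.shift x) = MarkovShift.shift (φ x))
    (f : C(MarkovShift.ShiftSpace A, ℤ)) (g : C(MarkovShift.ShiftSpace B, ℤ))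
    (hfg : ∀ x, f x = g (φ x)) :
    ∃ Φ : MarkovShift.extRuelle A ≃⋆ₐ[ℂ] MarkovShift.extRuelle B,
      Φ '' MarkovShift.diagonal A = MarkovShift.diagonal B ∧
      ∀ (r s : UnitAddCircle) (a : MarkovShift.extRuelle A),
        Φ (MarkovShift.gaugeAction f r s a) = MarkovShift.gaugeAction g r s (Φ a) :=
  proposition5p4_general φ hφ f g hfg
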